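/- Let $X$ be a connected smooth manifold (Hausdorff, second countable), with sheaf of smooth functions $\mathcal C^\infty_X$ and cotangent bundle $T_X^*$; vector bundles are smooth, real and of finite rank, and are identified with their sheaves of smooth sections. Let $Q=(Q_0,Q_1,s,t)$ be a finite quiver and let $M=\{M_a\}_{a\in Q_1}$ be vector bundles on $X$. An $M$-twisted $Q$-bundle $\mathcal R=(\mathcal E,\phi)$ consists of vector bundles $\mathcal E_i$ $(i\in Q_0)$ and morphisms $\phi_a:\mathcal E_{s(a)}\otimes M_a\to\mathcal E_{t(a)}$ $(a\in Q_1)$. Put $T_X^*\otimes\mathcal R=(\{T_X^*\otimes\mathcal E_i\},\{\mathrm{id}_{T_X^*}\otimes\phi_a\})$. A smooth relative connection on $\mathcal R$ consists of smooth connections $\nabla_i$ on the $\mathcal E_i$ and $\nabla_a$ on the $M_a$ such that $$(\mathrm{id}_{T_X^*}\otimes\phi_a)\circ(\nabla_{s(a)}\otimes\nabla_a)=\nabla_{t(a)}\circ\phi_a\qquad\text{for all }a\in Q_1,$$ where $\nabla_{s(a)}\otimes\nabla_a:=\nabla_{s(a)}\otimes\mathrm{id}+\mathrm{id}\otimes\nabla_a$;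 we say that it induces the connections $\nabla_a$ on the $M_a$. Let $\mathcal S=\bigoplus_{i\in Q_0}\mathcal C^\infty_X e_i$ with orthogonal idempotents $e_i$, let $\mathcal M=\bigoplus_{a\in Q_1}M_a$ be the $\mathcal S$-bimodule on which, for $m\in M_a$, $e_i m=m$ if $i=t(a)$ and $0$ otherwise, and $m e_i=m$ if $i=s(a)$ and $0$ otherwise, and let $\mathcal A=\bigoplus_{n\ge0}\mathcal M^{\otimes_{\mathcal S}n}$ be its tensor algebra, a sheaf of rings. An $M$-twisted $Q$-bundle $\mathcal R$ is regarded as the sheaf of $\mathcal A$-modules $\bigoplus_i\mathcal E_i$, where $e_i$ acts as the projection to $\mathcal E_i$ and $m\in M_a$ acts by $e\mapsto\phi_a(e\otimes m)$ for $e\in\mathcal E_{s(a)}$ and by $0$ on the other summands (with the conventions above this is a left action). Let $$\delta:\bigoplus_{a\in Q_1}\mathrm{Hom}_{\mathcal C^\infty_X}(\mathcal E_{s(a)}\otimes M_a,\;T_X^*\otimes\mathcal E_{t(a)})\longrightarrow\mathrm{Ext}^1_{\mathcal A}(\mathcal R,\;T_X^*\otimes\mathcal R)$$ be the canonical map: $\delta(\{\gamma_a\})$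 is the class of the extension $$0\to T_X^*\otimes\mathcal R\to\{(T_X^*\otimes\mathcal E_i)\oplus\mathcal E_i\}_{i\in Q_0}\to\mathcal R\to0$$ in which the arrow $a$ acts by $(\eta,e)\otimes m\mapsto\big((\mathrm{id}\otimes\phi_a)(\eta\otimes m)+\gamma_a(e\otimes m),\;\phi_a(e\otimes m)\big)$. Here $\mathrm{Ext}^1_{\mathcal A}$ is taken in the category of sheaves of $\mathcal A$-modules. Fix smooth connections $\nabla_a$ on the $M_a$, let $\nabla^0_i$ be any smooth connections on the $\mathcal E_i$, and let $$\beta_a=(\mathrm{id}\otimes\phi_a)\circ(\nabla^0_{s(a)}\otimes\nabla_a)-\nabla^0_{t(a)}\circ\phi_a\in\mathrm{Hom}_{\mathcal C^\infty_X}(\mathcal E_{s(a)}\otimes M_a,\;T_X^*\otimes\mathcal E_{t(a)}).$$ Then $\mathcal R$ admits a smooth relative connection inducing the given connections $\nabla_a$ on the $M_a$ for all $a\in Q_1$ if and only if $\delta(\{\beta_a\}_{a\in Q_1})=0$ in $\mathrm{Ext}^1_{\mathcal A}(\mathcal R,T_X^*\otimes\mathcal R)$. -/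

import Mathlib

open CategoryTheory TopologicalSpace Opposite Bundle
open scoped Manifold ContDiff TensorProduct Topology

universe u

namespace QuiverBundle

noncomputable section

section Bimodule

variable (S M : Type u) [Ring S] [AddCommGroup M] [Module S M] [Module Sᵐᵒᵖ M]

/-- The defining relations of the tensor algebra of an `S`-bimodule `M`, in the free ring on
the disjoint union of `S` and `M`. -/
inductive BimoduleRel : FreeAlgebra ℤ (S ⊕ M) → FreeAlgebra ℤ (S ⊕ M) → Prop
  | scalar_add (r r' : S) : BimoduleRel (FreeAlgebra.ι ℤ (Sum.inl (r + r')))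
      (FreeAlgebra.ι ℤ (Sum.inl r) + FreeAlgebra.ι ℤ (Sum.inl r'))
  | scalar_mul (r r' : S) : BimoduleRel (FreeAlgebra.ι ℤ (Sum.inl (r * r')))
      (FreeAlgebra.ι ℤ (Sum.inl r) * FreeAlgebra.ι ℤ (Sum.inl r'))
  | scalar_one : BimoduleRel (FreeAlgebra.ι ℤ (Sum.inl 1)) 1
  | vector_add (m m' : M) : BimoduleRel (FreeAlgebra.ι ℤ (Sum.inr (m + m')))
      (FreeAlgebra.ι ℤ (Sum.inr m) + FreeAlgebra.ι ℤ (Sum.inr m'))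
  | left_smul (r : S) (m : M) : BimoduleRel (FreeAlgebra.ι ℤ (Sum.inr (r • m)))
      (FreeAlgebra.ι ℤ (Sum.inl r) * FreeAlgebra.ι ℤ (Sum.inr m))
  | right_smul (r : S) (m : M) : BimoduleRel (FreeAlgebra.ι ℤ (Sum.inr (MulOpposite.op r • m)))
      (FreeAlgebra.ι ℤ (Sum.inr m) * FreeAlgebra.ι ℤ (Sum.inl r))

/-- The tensor algebra `T_S(M) = ⨁ n, M ⊗_S ⋯ ⊗_S M` of an `S`-bimodule `M`, presented by
its universal property: ring homomorphisms `T_S(M) → B` are the pairs of a ring homomorphism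
`S → B` and an additive map `M → B` that is compatible with both actions. -/
def BimoduleTensorAlgebra : Type u := RingQuot (BimoduleRel S M)

instance : Ring (BimoduleTensorAlgebra S M) := inferInstanceAs (Ring (RingQuot (BimoduleRel S M)))

namespace BimoduleTensorAlgebra

variable {S M}

variable (S M) in
/-- The quotient map from the free ring. -/
def quot : FreeAlgebra ℤ (S ⊕ M) →+* BimoduleTensorAlgebra S M :=
  RingQuot.mkRingHom (BimoduleRel S M)

/-- The canonical map `S → T_S(M)`. -/
def scalar (r : S) : BimoduleTensorAlgebra S M := quot S M (FreeAlgebra.ι ℤ (Sum.inl r))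

/-- The canonical map `M → T_S(M)`. -/
def vector (m : M) : BimoduleTensorAlgebra S M := quot S M (FreeAlgebra.ι ℤ (Sum.inr m))

/-- The universal property of the tensor algebra. -/
def lift {B : Type*} [Ring B] (f : S →+* B) (g : M →+ B)
    (hl : ∀ (r : S) (m : M), g (r • m) = f r * g m)
    (hr : ∀ (r : S) (m : M), g (MulOpposite.op r • m) = g m * f r) :
    BimoduleTensorAlgebra S M →+* B :=
  RingQuot.lift ⟨(FreeAlgebra.lift ℤ (Sum.elim f g)).toRingHom, by
    intro x y h
    induction h with
    | scalar_add r r' => simp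
    | scalar_mul r r' => simp
    | scalar_one => simp
    | vector_add m m' => simp
    | left_smul r m => simp [hl]
    | right_smul r m => simp [hr]⟩

@[simp]
theorem lift_scalar {B : Type*} [Ring B] (f : S →+* B) (g : M →+ B) (hl) (hr) (r : S) :
    lift f g hl hr (scalar r) = f r :=
  (RingQuot.lift_mkRingHom_apply _ _ _).trans (by simp)

@[simp]
theorem lift_vector {B : Type*} [Ring B] (f : S →+* B) (g : M →+ B) (hl) (hr) (m : M) :
    lift f g hl hr (vector m) = g m :=
  (RingQuot.lift_mkRingHom_apply _ _ _).trans (by simp)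

theorem ringHom_ext {B : Type*} [Ring B] {f g : BimoduleTensorAlgebra S M →+* B}
    (hs : ∀ r, f (scalar r) = g (scalar r)) (hv : ∀ m, f (vector m) = g (vector m)) : f = g := by
  apply RingQuot.ringQuot_ext
  let f' : FreeAlgebra ℤ (S ⊕ M) →ₐ[ℤ] B :=
    (f.comp (RingQuot.mkRingHom (BimoduleRel S M))).toIntAlgHom
  let g' : FreeAlgebra ℤ (S ⊕ M) →ₐ[ℤ] B :=
    (g.comp (RingQuot.mkRingHom (BimoduleRel S M))).toIntAlgHom
  have : f' = g' := by
    apply FreeAlgebra.hom_ext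
    funext x
    rcases x with r | m
    · exact hs r
    · exact hv m
  exact congrArg (fun k : FreeAlgebra ℤ (S ⊕ M) →ₐ[ℤ] B ↦ (k : FreeAlgebra ℤ (S ⊕ M) →+* B)) this

theorem scalar_add (r r' : S) :
    (scalar (r + r') : BimoduleTensorAlgebra S M) = scalar r + scalar r' :=
  (RingQuot.mkRingHom_rel (BimoduleRel.scalar_add r r')).trans (map_add _ _ _)

theorem scalar_mul (r r' : S) :
    (scalar (r * r') : BimoduleTensorAlgebra S M) = scalar r * scalar r' :=
  (RingQuot.mkRingHom_rel (BimoduleRel.scalar_mul r r')).trans (map_mul _ _ _)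

theorem scalar_one : (scalar 1 : BimoduleTensorAlgebra S M) = 1 :=
  (RingQuot.mkRingHom_rel BimoduleRel.scalar_one).trans (map_one _)

theorem vector_add (m m' : M) :
    (vector (m + m') : BimoduleTensorAlgebra S M) = vector m + vector m' :=
  (RingQuot.mkRingHom_rel (BimoduleRel.vector_add m m')).trans (map_add _ _ _)

theorem vector_smul (r : S) (m : M) :
    (vector (r • m) : BimoduleTensorAlgebra S M) = scalar r * vector m :=
  (RingQuot.mkRingHom_rel (BimoduleRel.left_smul r m)).trans (map_mul _ _ _)

theorem vector_op_smul (r : S) (m : M) :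
    (vector (MulOpposite.op r • m) : BimoduleTensorAlgebra S M) = vector m * scalar r :=
  (RingQuot.mkRingHom_rel (BimoduleRel.right_smul r m)).trans (map_mul _ _ _)

/-- The canonical ring homomorphism `S → T_S(M)`. -/
def scalarHom : S →+* BimoduleTensorAlgebra S M :=
  RingHom.mk' ⟨⟨scalar, scalar_one⟩, scalar_mul⟩ scalar_add

theorem scalarHom_apply (r : S) : (scalarHom r : BimoduleTensorAlgebra S M) = scalar r := rfl

/-- The canonical additive map `M → T_S(M)`. -/
def vectorHom : M →+ BimoduleTensorAlgebra S M := AddMonoidHom.mk' vector vector_add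

theorem vectorHom_apply (m : M) : (vectorHom m : BimoduleTensorAlgebra S M) = vector m := rfl

/-- Functoriality of the tensor algebra in the pair `(S, M)`. -/
def map {S' M' : Type u} [Ring S'] [AddCommGroup M'] [Module S' M'] [Module S'ᵐᵒᵖ M']
    (f : S →+* S') (g : M →+ M') (hl : ∀ (r : S) (m : M), g (r • m) = f r • g m)
    (hr : ∀ (r : S) (m : M), g (MulOpposite.op r • m) = MulOpposite.op (f r) • g m) :
    BimoduleTensorAlgebra S M →+* BimoduleTensorAlgebra S' M' :=
  lift (scalarHom.comp f) (vectorHom.comp g)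
    (fun r m ↦ by simp [hl, vectorHom_apply, scalarHom_apply, vector_smul])
    (fun r m ↦ by simp [hr, vectorHom_apply, scalarHom_apply, vector_op_smul])

@[simp]
theorem map_scalar {S' M' : Type u} [Ring S'] [AddCommGroup M'] [Module S' M']
    [Module S'ᵐᵒᵖ M'] (f : S →+* S') (g : M →+ M') (hl) (hr) (r : S) :
    map f g hl hr (scalar r) = scalar (f r) :=
  lift_scalar _ _ _ _ r

@[simp]
theorem map_vector {S' M' : Type u} [Ring S'] [AddCommGroup M'] [Module S' M']
    [Module S'ᵐᵒᵖ M'] (f : S →+* S') (g : M →+ M') (hl) (hr) (m : M) :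
    map f g hl hr (vector m) = vector (g m) :=
  lift_vector _ _ _ _ m

/-- Semilinearity of an additive map can be tested on the generators of the tensor algebra. -/
theorem smul_compat {S' M' : Type u} [Ring S'] [AddCommGroup M'] [Module S' M']
    [Module S'ᵐᵒᵖ M'] {N N' : Type*} [AddCommGroup N] [AddCommGroup N']
    [Module (BimoduleTensorAlgebra S M) N] [Module (BimoduleTensorAlgebra S' M') N']
    (k : BimoduleTensorAlgebra S M →+* BimoduleTensorAlgebra S' M') (p : N →+ N')
    (hs : ∀ (r : S) (n : N), p ((scalar r : BimoduleTensorAlgebra S M) • n) = k (scalar r) • p n)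
    (hv : ∀ (m : M) (n : N), p ((vector m : BimoduleTensorAlgebra S M) • n) = k (vector m) • p n)
    (x : BimoduleTensorAlgebra S M) (n : N) : p (x • n) = k x • p n := by
  obtain ⟨y, rfl⟩ : ∃ y, quot S M y = x := RingQuot.mkRingHom_surjective (BimoduleRel S M) x
  induction y using FreeAlgebra.induction generalizing n with
  | grade0 z =>
    rw [eq_intCast, map_intCast, map_intCast, Int.cast_smul_eq_zsmul, Int.cast_smul_eq_zsmul,
      map_zsmul]
  | grade1 z =>
    rcases z with r | m
    · exact hs r n
    · exact hv m n
  | mul a b ha hb => rw [map_mul, mul_smul, map_mul, mul_smul, ← hb, ha]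
  | add a b ha hb => rw [map_add, add_smul, map_add, map_add, add_smul, ha, hb]

end BimoduleTensorAlgebra

end Bimodule

section Bundles

variable {d : ℕ} {X : Type u} [TopologicalSpace X] [ChartedSpace (EuclideanSpace ℝ (Fin d)) X]

/-- A smooth real vector bundle of finite rank over the `d`-dimensional manifold `X`. -/
structure SmoothVB (d : ℕ) (X : Type u) [TopologicalSpace X]
    [ChartedSpace (EuclideanSpace ℝ (Fin d)) X] where
  /-- the model fibre -/
  Model : Type u
  /-- the fibres -/
  Fiber : X → Type u
  [normedAddCommGroup : NormedAddCommGroup Model]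
  [normedSpace : NormedSpace ℝ Model]
  [finiteDimensional : FiniteDimensional ℝ Model]
  [topTotal : TopologicalSpace (TotalSpace Model Fiber)]
  [addCommGroup : ∀ x, AddCommGroup (Fiber x)]
  [module : ∀ x, Module ℝ (Fiber x)]
  [topFiber : ∀ x, TopologicalSpace (Fiber x)]
  [topAddGroup : ∀ x, IsTopologicalAddGroup (Fiber x)]
  [contSMul : ∀ x, ContinuousSMul ℝ (Fiber x)]
  [fiberBundle : FiberBundle Model Fiber]
  [vectorBundle : VectorBundle ℝ Model Fiber]
  [contMDiff : ContMDiffVectorBundle ∞ Model Fiber (𝓡 d)]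

attribute [instance] SmoothVB.normedAddCommGroup SmoothVB.normedSpace SmoothVB.finiteDimensional
  SmoothVB.topTotal SmoothVB.addCommGroup SmoothVB.module SmoothVB.topFiber
  SmoothVB.topAddGroup SmoothVB.contSMul SmoothVB.fiberBundle SmoothVB.vectorBundle
  SmoothVB.contMDiff

/-- The ring `C^∞(U)` of smooth real functions on the open set `U`. -/
abbrev SmoothFun (d : ℕ) {X : Type u} [TopologicalSpace X]
    [ChartedSpace (EuclideanSpace ℝ (Fin d)) X] (U : Opens X) : Type u :=
  C^∞⟮𝓡 d, U; 𝓘(ℝ), ℝ⟯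

/-- Smoothness of a section of `E` over the open set `U`. -/
def IsSmoothSec (E : SmoothVB d X) (U : Opens X) (σ : ∀ x : U, E.Fiber x) : Prop :=
  ContMDiff (𝓡 d) ((𝓡 d).prod 𝓘(ℝ, E.Model)) ∞
    (fun x : U ↦ TotalSpace.mk' E.Model (x : X) (σ x))

open Classical in
/-- Extension by zero of a section over `U` to a (generally discontinuous) section over `X`. -/
def extZero (E : SmoothVB d X) {U : Opens X} (σ : ∀ x : U, E.Fiber x) : ∀ x : X, E.Fiber x :=
  fun x ↦ if h : x ∈ U then σ ⟨x, h⟩ else 0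

theorem extZero_coe (E : SmoothVB d X) {U : Opens X} (σ : ∀ x : U, E.Fiber x) (x : U) :
    extZero E σ x = σ x := by
  simp [extZero]

theorem extZero_of_mem (E : SmoothVB d X) {U : Opens X} (σ : ∀ x : U, E.Fiber x) {x : X}
    (hx : x ∈ U) : extZero E σ x = σ ⟨x, hx⟩ := by
  simp [extZero, hx]

/-- Smoothness at a point of a section defined on all of `X`. -/
abbrev SmoothAt (E : SmoothVB d X) (σ : ∀ x : X, E.Fiber x) (x : X) : Prop :=
  ContMDiffAt (𝓡 d) ((𝓡 d).prod 𝓘(ℝ, E.Model)) ∞ (fun y : X ↦ TotalSpace.mk' E.Model y (σ y)) x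

theorem isSmoothSec_restrict_iff (E : SmoothVB d X) {U : Opens X} (σ : ∀ x : X, E.Fiber x) :
    IsSmoothSec E U (fun x : U ↦ σ x) ↔ ∀ x ∈ U, SmoothAt E σ x := by
  constructor
  · intro h x hx
    exact contMDiffAt_subtype_iff (x := (⟨x, hx⟩ : U)) |>.1 (h ⟨x, hx⟩)
  · intro h x
    exact contMDiffAt_subtype_iff.2 (h x x.2)

theorem isSmoothSec_iff (E : SmoothVB d X) {U : Opens X} (σ : ∀ x : U, E.Fiber x) :
    IsSmoothSec E U σ ↔ ∀ x ∈ U, SmoothAt E (extZero E σ) x := by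
  rw [← isSmoothSec_restrict_iff]
  simp only [extZero_coe]

/-- The subgroup of smooth sections of `E` over `U`. -/
def secSubgroup (E : SmoothVB d X) (U : Opens X) : AddSubgroup (∀ x : U, E.Fiber x) where
  carrier := {σ | IsSmoothSec E U σ}
  add_mem' {σ τ} hσ hτ := by
    simp only [Set.mem_ofPred_eq, isSmoothSec_iff] at hσ hτ ⊢
    intro x hx
    have h := (hσ x hx).add_section (hτ x hx)
    refine h.congr_of_eventuallyEq ?_
    filter_upwards [U.2.mem_nhds hx] with y hy
    simp [extZero_of_mem E _ hy]
  zero_mem' := by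
    simp only [Set.mem_ofPred_eq, isSmoothSec_iff]
    intro x hx
    refine (contMDiffAt_zeroSection ℝ E.Fiber).congr_of_eventuallyEq ?_
    filter_upwards [U.2.mem_nhds hx] with y hy
    simp [extZero_of_mem E _ hy, zeroSection]
  neg_mem' {σ} hσ := by
    simp only [Set.mem_ofPred_eq, isSmoothSec_iff] at hσ ⊢
    intro x hx
    refine (hσ x hx).neg_section.congr_of_eventuallyEq ?_
    filter_upwards [U.2.mem_nhds hx] with y hy
    simp [extZero_of_mem E _ hy]

/-- `Γ(U, E)`, the smooth sections of `E` over the open set `U`. -/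
abbrev Sec (E : SmoothVB d X) (U : Opens X) : Type u := secSubgroup E U

/-- The element of `Γ(U, E)` given by a smooth section. -/
def Sec.mk {E : SmoothVB d X} {U : Opens X} (σ : ∀ x : U, E.Fiber x) (hσ : IsSmoothSec E U σ) :
    Sec E U := ⟨σ, hσ⟩

@[simp]
theorem Sec.mk_val {E : SmoothVB d X} {U : Opens X} (σ : ∀ x : U, E.Fiber x)
    (hσ : IsSmoothSec E U σ) : (Sec.mk σ hσ).1 = σ := rfl

theorem Sec.smooth {E : SmoothVB d X} {U : Opens X} (σ : Sec E U) : IsSmoothSec E U σ.1 := σ.2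

theorem add_sec_apply {E : SmoothVB d X} {U : Opens X} (σ τ : Sec E U) (x : U) :
    (σ + τ).1 x = σ.1 x + τ.1 x := rfl

theorem isSmoothSec_smul (E : SmoothVB d X) {U : Opens X} (f : SmoothFun d U)
    {σ : ∀ x : U, E.Fiber x} (hσ : IsSmoothSec E U σ) :
    IsSmoothSec E U (fun x ↦ f x • σ x) := by
  classical
  rw [isSmoothSec_iff] at hσ ⊢
  intro x hx
  let g : X → ℝ := fun y ↦ if h : y ∈ U then f ⟨y, h⟩ else 0
  have hg : ContMDiffAt (𝓡 d) 𝓘(ℝ) ∞ g x := by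
    refine contMDiffAt_subtype_iff (x := (⟨x, hx⟩ : U)) |>.1 ?_
    have : (fun y : U ↦ g y) = f := by
      ext y
      simp [g]
    rw [this]
    exact f.contMDiff.contMDiffAt
  refine (hg.smul_section (hσ x hx)).congr_of_eventuallyEq ?_
  filter_upwards [U.2.mem_nhds hx] with y hy
  have hy' : y ∈ U := hy
  simp [extZero_of_mem E _ hy', g, hy']

instance (E : SmoothVB d X) (U : Opens X) : Module (SmoothFun d U) (Sec E U) where
  smul f σ := Sec.mk (fun x ↦ f x • σ.1 x) (isSmoothSec_smul E f σ.smooth)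
  one_smul σ := Subtype.ext (funext fun x ↦ one_smul ℝ (σ.1 x))
  mul_smul f g σ := Subtype.ext (funext fun x ↦ mul_smul (f x) (g x) (σ.1 x))
  smul_zero f := Subtype.ext (funext fun x ↦ smul_zero (f x))
  smul_add f σ τ := Subtype.ext (funext fun x ↦ smul_add (f x) (σ.1 x) (τ.1 x))
  add_smul f g σ := Subtype.ext (funext fun x ↦ add_smul (f x) (g x) (σ.1 x))
  zero_smul σ := Subtype.ext (funext fun x ↦ zero_smul ℝ (σ.1 x))

theorem smul_coe (E : SmoothVB d X) {U : Opens X} (f : SmoothFun d U) (σ : Sec E U) (x : U) :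
    (f • σ).1 x = f x • σ.1 x := rfl

/-- Restriction of smooth functions to a smaller open set. -/
def resFun {U V : Opens X} (h : V ≤ U) : SmoothFun d U →+* SmoothFun d V where
  toFun f := ⟨fun x ↦ f (Opens.inclusion h x), f.contMDiff.comp (contMDiff_inclusion h)⟩
  map_one' := rfl
  map_mul' _ _ := rfl
  map_zero' := rfl
  map_add' _ _ := rfl

/-- Restriction of smooth sections to a smaller open set. -/
def resSec (E : SmoothVB d X) {U V : Opens X} (h : V ≤ U) : Sec E U →+ Sec E V where
  toFun σ := Sec.mk (fun x ↦ σ.1 (Opens.inclusion h x))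
    (ContMDiff.comp σ.smooth (contMDiff_inclusion h))
  map_zero' := rfl
  map_add' _ _ := rfl

open Classical in
/-- Extension by zero of a smooth function on `U`. -/
def extFun {U : Opens X} (f : SmoothFun d U) : X → ℝ :=
  fun y ↦ if h : y ∈ U then f ⟨y, h⟩ else 0

theorem extFun_coe {U : Opens X} (f : SmoothFun d U) (x : U) : extFun f x = f x := by
  simp [extFun]

theorem contMDiffAt_extFun {U : Opens X} (f : SmoothFun d U) {x : X} (hx : x ∈ U) :
    ContMDiffAt (𝓡 d) 𝓘(ℝ) ∞ (extFun f) x := by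
  refine contMDiffAt_subtype_iff (x := (⟨x, hx⟩ : U)) |>.1 ?_
  simp only [extFun_coe]
  exact f.contMDiff.contMDiffAt

/-- A section of a bundle of homomorphisms is smooth at a point as soon as it takes smooth
local sections to smooth local sections. -/
theorem smoothAt_hom_of_frame {F₁ F₂ : Type*} {E₁ E₂ : X → Type*}
    [NormedAddCommGroup F₁] [NormedSpace ℝ F₁] [FiniteDimensional ℝ F₁]
    [NormedAddCommGroup F₂] [NormedSpace ℝ F₂]
    [TopologicalSpace (TotalSpace F₁ E₁)] [TopologicalSpace (TotalSpace F₂ E₂)]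
    [∀ x, AddCommGroup (E₁ x)] [∀ x, Module ℝ (E₁ x)] [∀ x, TopologicalSpace (E₁ x)]
    [∀ x, AddCommGroup (E₂ x)] [∀ x, Module ℝ (E₂ x)] [∀ x, TopologicalSpace (E₂ x)]
    [∀ x, IsTopologicalAddGroup (E₂ x)] [∀ x, ContinuousSMul ℝ (E₂ x)]
    [FiberBundle F₁ E₁] [VectorBundle ℝ F₁ E₁] [FiberBundle F₂ E₂] [VectorBundle ℝ F₂ E₂]
    [ContMDiffVectorBundle ∞ F₁ E₁ (𝓡 d)] [ContMDiffVectorBundle ∞ F₂ E₂ (𝓡 d)]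
    (A : ∀ x : X, E₁ x →L[ℝ] E₂ x) (x : X)
    (hA : ∀ s : (∀ y : X, E₁ y), (∀ᶠ y in 𝓝 x, ContMDiffAt (𝓡 d) ((𝓡 d).prod 𝓘(ℝ, F₁)) ∞
        (fun y ↦ TotalSpace.mk' F₁ y (s y)) y) →
      ContMDiffAt (𝓡 d) ((𝓡 d).prod 𝓘(ℝ, F₂)) ∞ (fun y ↦ TotalSpace.mk' F₂ y (A y (s y))) x) :
    ContMDiffAt (𝓡 d) ((𝓡 d).prod 𝓘(ℝ, F₁ →L[ℝ] F₂)) ∞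
      (fun y ↦ TotalSpace.mk' (F₁ →L[ℝ] F₂) (E := fun y ↦ E₁ y →L[ℝ] E₂ y) y (A y)) x := by
  rw [contMDiffAt_hom_bundle]
  refine ⟨contMDiffAt_id, ?_⟩
  dsimp only
  let e₁ := trivializationAt F₁ E₁ x
  let e₂ := trivializationAt F₂ E₂ x
  let b := Module.finBasis ℝ F₁
  have key : ∀ i, ContMDiffAt (𝓡 d) 𝓘(ℝ, F₂) ∞
      (fun y ↦ (e₂ (TotalSpace.mk' F₂ y (A y (e₁.localFrame b i y)))).2) x := by
    intro i
    have h := hA (e₁.localFrame b i) (by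
      filter_upwards [e₁.open_baseSet.mem_nhds (FiberBundle.mem_baseSet_trivializationAt' x)]
        with y hy
      exact contMDiffAt_localFrame_of_mem (I := 𝓡 d) ∞ e₁ b i hy)
    rw [contMDiffAt_totalSpace] at h
    exact h.2
  have hsum : ContMDiffAt (𝓡 d) 𝓘(ℝ, F₁ →L[ℝ] F₂) ∞
      (fun y ↦ ∑ i, (LinearMap.toContinuousLinearMap (b.coord i)).smulRight
        ((e₂ (TotalSpace.mk' F₂ y (A y (e₁.localFrame b i y)))).2)) x := by
    refine ContMDiffAt.sum fun i _ ↦ ?_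
    exact (ContinuousLinearMap.smulRightL ℝ F₁ F₂
      (LinearMap.toContinuousLinearMap (b.coord i))).contMDiff.contMDiffAt.comp x (key i)
  refine hsum.congr_of_eventuallyEq ?_
  filter_upwards [e₁.open_baseSet.mem_nhds (FiberBundle.mem_baseSet_trivializationAt' x),
    e₂.open_baseSet.mem_nhds (FiberBundle.mem_baseSet_trivializationAt' x)] with y hy₁ hy₂
  rw [ContinuousLinearMap.inCoordinates_eq hy₁ hy₂]
  refine ContinuousLinearMap.coe_injective (b.ext fun j ↦ ?_)
  simp only [ContinuousLinearMap.coe_coe, _root_.sum_apply,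
    ContinuousLinearMap.smulRight_apply, LinearMap.coe_toContinuousLinearMap', Module.Basis.coord_apply,
    Module.Basis.repr_self, Finsupp.single_apply, ite_smul, one_smul, zero_smul,
    Finset.sum_ite_eq, Finset.mem_univ, if_true, ContinuousLinearMap.comp_apply]
  simp [e₁, e₂, hy₁, Trivialization.localFrame, Trivialization.basisAt]

theorem mdifferentiableAt_ext {E : SmoothVB d X} {U : Opens X} (σ : Sec E U) {x : X}
    (hx : x ∈ U) : MDifferentiableAt (𝓡 d) ((𝓡 d).prod 𝓘(ℝ, E.Model))
      (fun y : X ↦ TotalSpace.mk' E.Model y (extZero E σ.1 y)) x :=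
  ((isSmoothSec_iff E σ.1).1 σ.2 x hx).mdifferentiableAt (by simp)

/-- A morphism of smooth vector bundles `E ⊗ M → E'`: a family of linear maps
`E_x ⊗ M_x → E'_x` that takes smooth local sections to smooth local sections. -/
structure TensorHom (E M E' : SmoothVB d X) where
  /-- the linear maps on the fibres -/
  map : ∀ x : X, E.Fiber x ⊗[ℝ] M.Fiber x →ₗ[ℝ] E'.Fiber x
  smooth : ∀ (U : Opens X) (σ : Sec E U) (τ : Sec M U),
    IsSmoothSec E' U (fun x ↦ map x (σ.1 x ⊗ₜ τ.1 x))

/-- An element of `Hom(E ⊗ M, E')`, the homomorphisms of sheaves of `C^∞`-modules: by the universal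
property of the tensor product, a family of `C^∞(U)`-bilinear maps
`Γ(U, E) × Γ(U, M) → Γ(U, E')` that commutes with restriction. -/
structure SheafTensorHom (E M E' : SmoothVB d X) where
  /-- the bilinear map on sections over `U` -/
  map : ∀ U : Opens X, Sec E U →ₗ[SmoothFun d U] Sec M U →ₗ[SmoothFun d U] Sec E' U
  naturality : ∀ {U V : Opens X} (h : V ≤ U) (σ : Sec E U) (τ : Sec M U),
    resSec E' h (map U σ τ) = map V (resSec E h σ) (resSec M h τ)

/-- The homomorphism of sheaves of `C^∞`-modules given by a morphism of vector bundles. -/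
def TensorHom.toSheaf {E M E' : SmoothVB d X} (φ : TensorHom E M E') : SheafTensorHom E M E' where
  map U := LinearMap.mk₂ (SmoothFun d U)
    (fun σ τ ↦ Sec.mk (fun x ↦ φ.map x (σ.1 x ⊗ₜ τ.1 x)) (φ.smooth U σ τ))
    (fun σ σ' τ ↦ Subtype.ext (funext fun x ↦ by simp [TensorProduct.add_tmul]))
    (fun f σ τ ↦ Subtype.ext (funext fun x ↦ by
      rw [smul_coe, Sec.mk_val, Sec.mk_val, smul_coe, ← TensorProduct.smul_tmul', map_smul]))
    (fun σ τ τ' ↦ Subtype.ext (funext fun x ↦ by simp [TensorProduct.tmul_add]))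
    (fun f σ τ ↦ Subtype.ext (funext fun x ↦ by simp [smul_coe]))
  naturality _ _ _ := rfl

theorem toSheaf_apply {E M E' : SmoothVB d X} (φ : TensorHom E M E') {U : Opens X} (σ : Sec E U)
    (τ : Sec M U) (x : U) : (φ.toSheaf.map U σ τ).1 x = φ.map x (σ.1 x ⊗ₜ τ.1 x) := rfl

variable [IsManifold (𝓡 d) ∞ X]

/-- The bundle `T_X^* ⊗ E` of one-forms with values in `E`, as the bundle `Hom(TX, E)`. -/
abbrev formBundle (E : SmoothVB d X) : SmoothVB d X where
  Model := EuclideanSpace ℝ (Fin d) →L[ℝ] E.Model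
  Fiber := fun x ↦ TangentSpace (𝓡 d) x →L[ℝ] E.Fiber x

theorem isSmoothSec_form (E : SmoothVB d X) {U : Opens X}
    (A : ∀ x : U, TangentSpace (𝓡 d) (x : X) →L[ℝ] E.Fiber x)
    (hA : ∀ (V : Opens X) (h : V ≤ U) (v : ∀ x : X, TangentSpace (𝓡 d) x),
      (∀ x ∈ V, ContMDiffAt (𝓡 d) ((𝓡 d).prod 𝓘(ℝ, EuclideanSpace ℝ (Fin d))) ∞
        (fun y ↦ TotalSpace.mk' (EuclideanSpace ℝ (Fin d)) y (v y)) x) →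
      IsSmoothSec E V (fun x ↦ A (Opens.inclusion h x) (v x))) :
    IsSmoothSec (formBundle E) U A := by
  rw [isSmoothSec_iff]
  intro x hx
  refine smoothAt_hom_of_frame (extZero (formBundle E) A) x fun s hs ↦ ?_
  obtain ⟨W, hW, hWo, hxW⟩ := eventually_nhds_iff.1 hs
  let V : Opens X := ⟨W, hWo⟩ ⊓ U
  have hV := hA V inf_le_right s (fun y hy ↦ hW y hy.1)
  have hV' := (isSmoothSec_iff E _).1 hV x ⟨hxW, hx⟩
  refine hV'.congr_of_eventuallyEq ?_
  filter_upwards [V.2.mem_nhds (⟨hxW, hx⟩ : x ∈ V)] with y hy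
  have hy' : y ∈ V := hy
  rw [extZero_of_mem E _ hy', extZero_of_mem (formBundle E) _ hy'.2]

theorem isSmoothSec_form_apply (E : SmoothVB d X) {V : Opens X} (η : Sec (formBundle E) V)
    (v : ∀ x : X, TangentSpace (𝓡 d) x)
    (hv : ∀ x ∈ V, ContMDiffAt (𝓡 d) ((𝓡 d).prod 𝓘(ℝ, EuclideanSpace ℝ (Fin d))) ∞
        (fun y ↦ TotalSpace.mk' (EuclideanSpace ℝ (Fin d)) y (v y)) x) :
    IsSmoothSec E V (fun x ↦ η.1 x (v x)) := by
  intro x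
  refine ContMDiffAt.clm_bundle_apply (η.2 x) ?_
  exact contMDiffAt_subtype_iff (x := x) (f := fun y : X ↦
    TotalSpace.mk' (EuclideanSpace ℝ (Fin d)) y (v y)) |>.2 (hv x x.2)

instance (x : X) : T2Space (TangentSpace (𝓡 d) x) :=
  inferInstanceAs (T2Space (EuclideanSpace ℝ (Fin d)))

instance (x : X) : FiniteDimensional ℝ (TangentSpace (𝓡 d) x) :=
  inferInstanceAs (FiniteDimensional ℝ (EuclideanSpace ℝ (Fin d)))

/-- A linear map on a tangent space, as a continuous linear map. -/
def tangentCLM {V : Type u} [AddCommGroup V] [Module ℝ V] [TopologicalSpace V]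
    [IsTopologicalAddGroup V] [ContinuousSMul ℝ V] (x : X) :
    (TangentSpace (𝓡 d) x →ₗ[ℝ] V) →ₗ[ℝ] (TangentSpace (𝓡 d) x →L[ℝ] V) :=
  (LinearMap.toContinuousLinearMap (E := TangentSpace (𝓡 d) x) (F' := V)).toLinearMap

/-- The morphism `id ⊗ φ : (T_X^* ⊗ E) ⊗ M → T_X^* ⊗ E'` induced by `φ : E ⊗ M → E'`, that is
`(η ⊗ m) ↦ (v ↦ φ (η v ⊗ m))`. -/
def TensorHom.formLeft {E M E' : SmoothVB d X} (φ : TensorHom E M E') :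
    TensorHom (formBundle E) M (formBundle E') where
  map x := TensorProduct.lift (LinearMap.mk₂ ℝ
    (fun (η : TangentSpace (𝓡 d) x →L[ℝ] E.Fiber x) (m : M.Fiber x) ↦
      tangentCLM x (φ.map x ∘ₗ (TensorProduct.mk ℝ _ _).flip m ∘ₗ
        (η : TangentSpace (𝓡 d) x →ₗ[ℝ] E.Fiber x)))
    (fun η η' m ↦ by
      rw [← map_add]; congr 1; ext v; simp)
    (fun c η m ↦ by
      rw [← map_smul]; congr 1; ext v; simp)
    (fun η m m' ↦ by
      rw [← map_add]; congr 1; ext v; simp)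
    (fun c η m ↦ by
      rw [← map_smul]; congr 1; ext v; simp))
  smooth U η τ := by
    refine isSmoothSec_form E' _ fun V h v hv ↦ ?_
    exact φ.smooth V (Sec.mk _ (isSmoothSec_form_apply E (resSec _ h η) v hv)) (resSec M h τ)

/-- The morphism `id ⊗ φ : E ⊗ (T_X^* ⊗ M) → T_X^* ⊗ E'` induced by `φ : E ⊗ M → E'`, that is
`(e ⊗ η) ↦ (v ↦ φ (e ⊗ η v))`. -/
def TensorHom.formRight {E M E' : SmoothVB d X} (φ : TensorHom E M E') :
    TensorHom E (formBundle M) (formBundle E') where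
  map x := TensorProduct.lift (LinearMap.mk₂ ℝ
    (fun (e : E.Fiber x) (η : TangentSpace (𝓡 d) x →L[ℝ] M.Fiber x) ↦
      tangentCLM x (φ.map x ∘ₗ TensorProduct.mk ℝ _ _ e ∘ₗ
        (η : TangentSpace (𝓡 d) x →ₗ[ℝ] M.Fiber x)))
    (fun e e' η ↦ by
      rw [← map_add]; congr 1; ext v; simp)
    (fun c e η ↦ by
      rw [← map_smul]; congr 1; ext v; simp)
    (fun e η η' ↦ by
      rw [← map_add]; congr 1; ext v; simp [TensorProduct.tmul_add])
    (fun c e η ↦ by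
      rw [← map_smul]; congr 1; ext v; simp))
  smooth U σ η := by
    refine isSmoothSec_form E' _ fun V h v hv ↦ ?_
    exact φ.smooth V (resSec E h σ) (Sec.mk _ (isSmoothSec_form_apply M (resSec _ h η) v hv))

/-- The value `η_x(v)` of an `E`-valued one-form. -/
def formVal {E : SmoothVB d X} {U : Opens X} (x : U) (v : TangentSpace (𝓡 d) (x : X)) :
    Sec (formBundle E) U →+ E.Fiber x where
  toFun η := (η.1 x : TangentSpace (𝓡 d) (x : X) →L[ℝ] E.Fiber x) v
  map_zero' := rfl
  map_add' _ _ := rfl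

theorem formSec_ext {E : SmoothVB d X} {U : Opens X} {η η' : Sec (formBundle E) U}
    (h : ∀ (x : U) (v : TangentSpace (𝓡 d) (x : X)), formVal x v η = formVal x v η') : η = η' :=
  Subtype.ext (funext fun x ↦ ContinuousLinearMap.ext (h x))

theorem formVal_smul {E : SmoothVB d X} {U : Opens X} (f : SmoothFun d U)
    (η : Sec (formBundle E) U) (x : U) (v : TangentSpace (𝓡 d) (x : X)) :
    formVal x v (f • η) = f x • formVal x v η := rfl

theorem formVal_formLeft {E M E' : SmoothVB d X} (φ : TensorHom E M E') {U : Opens X}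
    (η : Sec (formBundle E) U) (τ : Sec M U) (x : U) (v : TangentSpace (𝓡 d) (x : X)) :
    formVal x v (φ.formLeft.toSheaf.map U η τ) = φ.map x (formVal x v η ⊗ₜ τ.1 x) := rfl

theorem formVal_formRight {E M E' : SmoothVB d X} (φ : TensorHom E M E') {U : Opens X}
    (σ : Sec E U) (η : Sec (formBundle M) U) (x : U) (v : TangentSpace (𝓡 d) (x : X)) :
    formVal x v (φ.formRight.toSheaf.map U σ η) = φ.map x (σ.1 x ⊗ₜ formVal x v η) := rfl

/-- A smooth connection on the vector bundle `E`. -/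
structure SmoothConnection (E : SmoothVB d X) where
  /-- the underlying covariant derivative -/
  cov : CovariantDerivative (𝓡 d) E.Model E.Fiber
  smooth : cov.ContMDiffCovariantDerivative ∞

variable [T2Space X]

theorem SmoothConnection.isSmoothSec {E : SmoothVB d X} (D : SmoothConnection E) {U : Opens X}
    (σ : Sec E U) :
    IsSmoothSec (formBundle E) U (fun x : U ↦ D.cov (extZero E σ.1) x) := by
  rw [isSmoothSec_restrict_iff (formBundle E) (D.cov (extZero E σ.1))]
  intro x hx
  obtain ⟨χ, -, hχ⟩ := (SmoothBumpFunction.nhds_basis_tsupport (I := 𝓡 d) x).mem_iff.1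
    (U.2.mem_nhds hx)
  have hσ : ContMDiffOn (𝓡 d) ((𝓡 d).prod 𝓘(ℝ, E.Model)) ∞
      (fun y : X ↦ TotalSpace.mk' E.Model y (extZero E σ.1 y)) U := fun y hy ↦
    ((isSmoothSec_iff E σ.1).1 σ.2 y hy).contMDiffWithinAt
  have hglob := ContMDiffOn.smul_section_of_tsupport (χ.contMDiff.contMDiffOn) U.2 hχ hσ
  have hcov := D.smooth.contMDiff.contMDiff (σ := (χ : X → ℝ) • extZero E σ.1)
    (by simpa using hglob.contMDiffOn)
  have hcov' := (hcov x (Set.mem_univ x)).contMDiffAt Filter.univ_mem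
  refine hcov'.congr_of_eventuallyEq ?_
  have hev := χ.eventuallyEq_one.eventually_nhds
  filter_upwards [hev, U.2.mem_nhds hx] with y hy hyU
  have : D.cov (extZero E σ.1) y = D.cov ((χ : X → ℝ) • extZero E σ.1) y := by
    refine D.cov.isCovariantDerivativeOnUniv.congr_of_eventuallyEq
      (mdifferentiableAt_ext σ hyU) (hglob.contMDiffAt.mdifferentiableAt (by simp))
      Filter.univ_mem ?_
    filter_upwards [hy] with z hz
    simp [hz]
  rw [this]

/-- The map of sheaves `∇ : E → T_X^* ⊗ E` given by a connection, on sections over `U`. -/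
def SmoothConnection.nabla {E : SmoothVB d X} (D : SmoothConnection E) {U : Opens X}
    (σ : Sec E U) : Sec (formBundle E) U :=
  Sec.mk (fun x ↦ D.cov (extZero E σ.1) x) (D.isSmoothSec σ)

theorem SmoothConnection.nabla_add {E : SmoothVB d X} (D : SmoothConnection E) {U : Opens X}
    (σ τ : Sec E U) : D.nabla (σ + τ) = D.nabla σ + D.nabla τ := by
  refine Subtype.ext (funext fun x ↦ ?_)
  have h : extZero E (σ + τ).1 = extZero E σ.1 + extZero E τ.1 := by
    funext y
    by_cases hy : y ∈ U <;> simp [extZero, hy]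
  change D.cov (extZero E (σ + τ).1) x = _
  rw [h, D.cov.isCovariantDerivativeOnUniv.add (mdifferentiableAt_ext σ x.2)
    (mdifferentiableAt_ext τ x.2)]
  rfl

theorem SmoothConnection.nabla_smul_apply {E : SmoothVB d X} (D : SmoothConnection E)
    {U : Opens X} (f : SmoothFun d U) (σ : Sec E U) (x : U) (v : TangentSpace (𝓡 d) (x : X)) :
    formVal x v (D.nabla (f • σ)) =
      f x • formVal x v (D.nabla σ) + (mvfderiv (𝓡 d) (extFun f) (x : X) v) • σ.1 x := by
  have h : extZero E (f • σ).1 = extFun f • extZero E σ.1 := by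
    funext y
    by_cases hy : y ∈ U <;> simp [extZero, extFun, hy, smul_coe]
  change D.cov (extZero E (f • σ).1) x v = _
  rw [h, D.cov.isCovariantDerivativeOnUniv.leibniz (mdifferentiableAt_ext σ x.2)
    ((contMDiffAt_extFun f x.2).mdifferentiableAt (by simp)), extFun_coe, extZero_coe]
  rfl

theorem SmoothConnection.nabla_res {E : SmoothVB d X} (D : SmoothConnection E) {U V : Opens X}
    (h : V ≤ U) (σ : Sec E U) :
    resSec (formBundle E) h (D.nabla σ) = D.nabla (resSec E h σ) := by
  refine Subtype.ext (funext fun x ↦ ?_)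
  refine D.cov.isCovariantDerivativeOnUniv.congr_of_eventuallyEq
    (mdifferentiableAt_ext σ (h x.2)) (mdifferentiableAt_ext (resSec E h σ) x.2)
    Filter.univ_mem ?_
  filter_upwards [V.2.mem_nhds x.2] with y hy
  rw [extZero_of_mem E _ (h hy), extZero_of_mem E _ hy]
  rfl

/-- `(id ⊗ φ) ((∇ ⊗ ∇') (σ ⊗ τ)) = (id ⊗ φ) (∇ σ ⊗ τ + σ ⊗ ∇' τ)`, a section of `T_X^* ⊗ E'`. -/
def tensorNabla {E M E' : SmoothVB d X} (φ : TensorHom E M E') (D : SmoothConnection E)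
    (D' : SmoothConnection M) {U : Opens X} (σ : Sec E U) (τ : Sec M U) :
    Sec (formBundle E') U :=
  φ.formLeft.toSheaf.map U (D.nabla σ) τ + φ.formRight.toSheaf.map U σ (D'.nabla τ)

/-- The morphism `φ : E ⊗ M → E'` is compatible with the connections:
`(id ⊗ φ) ∘ (∇ ⊗ ∇') = ∇'' ∘ φ`. -/
def Compatible {E M E' : SmoothVB d X} (φ : TensorHom E M E') (D : SmoothConnection E)
    (D' : SmoothConnection M) (D'' : SmoothConnection E') : Prop :=
  ∀ (U : Opens X) (σ : Sec E U) (τ : Sec M U),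
    tensorNabla φ D D' σ τ = D''.nabla (φ.toSheaf.map U σ τ)


/-- The value of the defect `(id ⊗ φ) ∘ (∇ ⊗ ∇') - ∇'' ∘ φ` on `σ ⊗ τ`. -/
def defectFun {E M E' : SmoothVB d X} (φ : TensorHom E M E') (D : SmoothConnection E)
    (D' : SmoothConnection M) (D'' : SmoothConnection E') {U : Opens X} (σ : Sec E U)
    (τ : Sec M U) : Sec (formBundle E') U :=
  tensorNabla φ D D' σ τ - D''.nabla (φ.toSheaf.map U σ τ)

theorem formVal_defectFun {E M E' : SmoothVB d X} (φ : TensorHom E M E') (D : SmoothConnection E)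
    (D' : SmoothConnection M) (D'' : SmoothConnection E') {U : Opens X} (σ : Sec E U)
    (τ : Sec M U) (x : U) (v : TangentSpace (𝓡 d) (x : X)) :
    formVal x v (defectFun φ D D' D'' σ τ) =
      φ.map x (formVal x v (D.nabla σ) ⊗ₜ τ.1 x) + φ.map x (σ.1 x ⊗ₜ formVal x v (D'.nabla τ)) -
        formVal x v (D''.nabla (φ.toSheaf.map U σ τ)) := rfl

/-- The defect `(id ⊗ φ) ∘ (∇ ⊗ ∇') - ∇'' ∘ φ`, which is linear over the smooth functions. -/
def defect {E M E' : SmoothVB d X} (φ : TensorHom E M E') (D : SmoothConnection E)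
    (D' : SmoothConnection M) (D'' : SmoothConnection E') :
    SheafTensorHom E M (formBundle E') where
  map U := LinearMap.mk₂ (SmoothFun d U) (fun σ τ ↦ defectFun φ D D' D'' σ τ)
    (fun σ σ' τ ↦ formSec_ext fun x v ↦ by
      simp only [formVal_defectFun, SmoothConnection.nabla_add, LinearMap.map_add, AddMonoidHom.map_add,
        LinearMap.add_apply, add_sec_apply, TensorProduct.add_tmul]
      abel)
    (fun f σ τ ↦ formSec_ext fun x v ↦ by
      simp only [formVal_defectFun, formVal_smul, LinearMap.map_smul, LinearMap.smul_apply,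
        SmoothConnection.nabla_smul_apply, smul_coe, toSheaf_apply, TensorProduct.add_tmul,
        ← TensorProduct.smul_tmul', LinearMap.map_add]
      module)
    (fun σ τ τ' ↦ formSec_ext fun x v ↦ by
      simp only [formVal_defectFun, SmoothConnection.nabla_add, LinearMap.map_add, AddMonoidHom.map_add,
        add_sec_apply, TensorProduct.tmul_add]
      abel)
    (fun f σ τ ↦ formSec_ext fun x v ↦ by
      simp only [formVal_defectFun, formVal_smul, LinearMap.map_smul,
        SmoothConnection.nabla_smul_apply, smul_coe, toSheaf_apply, TensorProduct.tmul_add,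
        TensorProduct.tmul_smul, LinearMap.map_add]
      module)
  naturality {U V} h σ τ := by
    change resSec (formBundle E') h (defectFun φ D D' D'' σ τ) =
      defectFun φ D D' D'' (resSec E h σ) (resSec M h τ)
    have e1 := φ.formLeft.toSheaf.naturality h (D.nabla σ) τ
    have e2 := φ.formRight.toSheaf.naturality h σ (D'.nabla τ)
    have e3 := D''.nabla_res h (φ.toSheaf.map U σ τ)
    rw [SmoothConnection.nabla_res] at e1 e2
    rw [SheafTensorHom.naturality] at e3
    change resSec (formBundle E') h (φ.formLeft.toSheaf.map U (D.nabla σ) τ +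
      φ.formRight.toSheaf.map U σ (D'.nabla τ) - D''.nabla (φ.toSheaf.map U σ τ)) = _
    rw [(resSec (formBundle E') h).map_sub, (resSec (formBundle E') h).map_add, e1, e2, e3]
    rfl

end Bundles

section PathAlgebra

variable {d : ℕ} {X : Type u} [TopologicalSpace X] [ChartedSpace (EuclideanSpace ℝ (Fin d)) X]
  {Q₀ Q₁ : Type u} (s t : Q₁ → Q₀) (M : Q₁ → SmoothVB d X)

/-- The sections over `U` of `𝒮 = ⨁ i, C^∞ e_i`, with the `e_i` orthogonal idempotents. -/
abbrev VertexRing (d : ℕ) {X : Type u} [TopologicalSpace X]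
    [ChartedSpace (EuclideanSpace ℝ (Fin d)) X] (Q₀ : Type u) (U : Opens X) : Type u :=
  Q₀ → SmoothFun d U

/-- The sections over `U` of `ℳ = ⨁ a, M_a`. -/
def ArrowModule (_s _t : Q₁ → Q₀) (M : Q₁ → SmoothVB d X) (U : Opens X) : Type u :=
  ∀ a, Sec (M a) U

instance (U : Opens X) : AddCommGroup (ArrowModule s t M U) :=
  inferInstanceAs (AddCommGroup (∀ a, Sec (M a) U))

/-- The left action of `𝒮` on `ℳ`: `e_i m = m` if `m ∈ M_a` with `i = t(a)`, and `0` otherwise. -/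
instance (U : Opens X) : Module (VertexRing d Q₀ U) (ArrowModule s t M U) where
  smul f m := fun a ↦ f (t a) • m a
  one_smul m := funext fun a ↦ one_smul (SmoothFun d U) (m a)
  mul_smul f g m := funext fun a ↦ mul_smul (f (t a)) (g (t a)) (m a)
  smul_zero f := funext fun a ↦ smul_zero (f (t a))
  smul_add f m m' := funext fun a ↦ smul_add (f (t a)) (m a) (m' a)
  add_smul f g m := funext fun a ↦ add_smul (f (t a)) (g (t a)) (m a)
  zero_smul m := funext fun a ↦ zero_smul (SmoothFun d U) (m a)

/-- The right action of `𝒮` on `ℳ`: `m e_i = m` if `m ∈ M_a` with `i = s(a)`, and `0` otherwise. -/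
instance (U : Opens X) : Module (VertexRing d Q₀ U)ᵐᵒᵖ (ArrowModule s t M U) where
  smul f m := fun a ↦ f.unop (s a) • m a
  one_smul m := funext fun a ↦ one_smul (SmoothFun d U) (m a)
  mul_smul f g m := funext fun a ↦ by
    change (g.unop (s a) * f.unop (s a)) • m a = f.unop (s a) • g.unop (s a) • m a
    rw [mul_comm, mul_smul]
  smul_zero f := funext fun a ↦ smul_zero (f.unop (s a))
  smul_add f m m' := funext fun a ↦ smul_add (f.unop (s a)) (m a) (m' a)
  add_smul f g m := funext fun a ↦ add_smul (f.unop (s a)) (g.unop (s a)) (m a)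
  zero_smul m := funext fun a ↦ zero_smul (SmoothFun d U) (m a)

/-- The tensor `𝒮(U)`-algebra of the bimodule `ℳ(U)`. -/
abbrev PathAlg (U : Opens X) : Type u :=
  BimoduleTensorAlgebra (VertexRing d Q₀ U) (ArrowModule s t M U)

theorem resSec_smul (E : SmoothVB d X) {U V : Opens X} (h : V ≤ U) (f : SmoothFun d U)
    (σ : Sec E U) : resSec E h (f • σ) = resFun h f • resSec E h σ := rfl

/-- Restriction of sections of `𝒮`. -/
def resVertex (Q₀ : Type u) {U V : Opens X} (h : V ≤ U) :
    VertexRing d Q₀ U →+* VertexRing d Q₀ V :=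
  RingHom.compLeft (resFun h) Q₀

/-- Restriction of sections of `ℳ`. -/
def resArrow {U V : Opens X} (h : V ≤ U) : ArrowModule s t M U →+ ArrowModule s t M V where
  toFun m := fun a ↦ resSec (M a) h (m a)
  map_zero' := rfl
  map_add' _ _ := rfl

theorem resArrow_smul {U V : Opens X} (h : V ≤ U) (f : VertexRing d Q₀ U)
    (m : ArrowModule s t M U) :
    resArrow s t M h (f • m) = resVertex Q₀ h f • resArrow s t M h m := rfl

theorem resArrow_op_smul {U V : Opens X} (h : V ≤ U) (f : VertexRing d Q₀ U)
    (m : ArrowModule s t M U) :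
    resArrow s t M h (MulOpposite.op f • m) =
      MulOpposite.op (resVertex Q₀ h f) • resArrow s t M h m := rfl

/-- Restriction of sections of the presheaf of tensor algebras. -/
def resPath {U V : Opens X} (h : V ≤ U) : PathAlg s t M U →+* PathAlg s t M V :=
  BimoduleTensorAlgebra.map (resVertex Q₀ h) (resArrow s t M h)
    (resArrow_smul s t M h) (resArrow_op_smul s t M h)

theorem resPath_scalar {U V : Opens X} (h : V ≤ U) (f : VertexRing d Q₀ U) :
    resPath s t M h (BimoduleTensorAlgebra.scalar f) =
      BimoduleTensorAlgebra.scalar (resVertex Q₀ h f) :=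
  BimoduleTensorAlgebra.map_scalar _ _ (resArrow_smul s t M h) (resArrow_op_smul s t M h) f

theorem resPath_vector {U V : Opens X} (h : V ≤ U) (m : ArrowModule s t M U) :
    resPath s t M h (BimoduleTensorAlgebra.vector m) =
      BimoduleTensorAlgebra.vector (resArrow s t M h m) :=
  BimoduleTensorAlgebra.map_vector _ _ (resArrow_smul s t M h) (resArrow_op_smul s t M h) m

theorem resPath_self (U : Opens X) : resPath s t M (le_refl U) = RingHom.id _ :=
  BimoduleTensorAlgebra.ringHom_ext (fun r ↦ resPath_scalar s t M (le_refl U) r)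
    (fun m ↦ resPath_vector s t M (le_refl U) m)

theorem resPath_resPath {U V W : Opens X} (h : V ≤ U) (h' : W ≤ V) :
    resPath s t M (h'.trans h) = (resPath s t M h').comp (resPath s t M h) :=
  BimoduleTensorAlgebra.ringHom_ext
    (fun r ↦ by
      rw [RingHom.comp_apply, resPath_scalar, resPath_scalar, resPath_scalar]
      rfl)
    (fun m ↦ by
      rw [RingHom.comp_apply, resPath_vector, resPath_vector, resPath_vector]
      rfl)

/-- The presheaf of rings `U ↦ T_{𝒮(U)}(ℳ(U))`. -/
def pathPresheaf : (Opens X)ᵒᵖ ⥤ RingCat.{u} where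
  obj U := RingCat.of (PathAlg s t M U.unop)
  map f := RingCat.ofHom (resPath s t M f.unop.le)
  map_id U := congrArg RingCat.ofHom (resPath_self s t M U.unop)
  map_comp f g := congrArg RingCat.ofHom (resPath_resPath s t M f.unop.le g.unop.le)

/-- The sheaf of rings `𝒜 = ⨁ n, ℳ ⊗_𝒮 ⋯ ⊗_𝒮 ℳ`, the `M`-twisted path algebra of the quiver:
the tensor algebra of the sheaf of `𝒮`-bimodules `ℳ`, that is the sheaf associated with
`U ↦ T_{𝒮(U)}(ℳ(U))`. -/
def pathSheaf : Sheaf (Opens.grothendieckTopology X) RingCat.{u} :=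
  (presheafToSheaf (Opens.grothendieckTopology X) RingCat.{u}).obj (pathPresheaf s t M)

/-- The canonical map from the presheaf of tensor algebras to its associated sheaf. -/
def toPathSheaf : pathPresheaf s t M ⟶ (pathSheaf s t M).obj :=
  toSheafify (Opens.grothendieckTopology X) (pathPresheaf s t M)

instance : Presheaf.IsLocallyInjective (Opens.grothendieckTopology X) (toPathSheaf s t M) := by
  unfold toPathSheaf pathSheaf
  infer_instance

instance : Presheaf.IsLocallySurjective (Opens.grothendieckTopology X) (toPathSheaf s t M) := by
  unfold toPathSheaf pathSheaf
  infer_instance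

/-- The abelian category of sheaves of `𝒜`-modules. -/
abbrev PathMod := SheafOfModules.{u} (pathSheaf s t M)

instance : HasExt.{u + 1} (PathMod s t M) := HasExt.standard _

/-- An `M`-twisted representation of the quiver in presheaves of `C^∞`-modules: a presheaf of
`C^∞`-modules `V i` for every vertex `i` and, for every arrow `a`, a morphism
`V (s a) ⊗ M_a → V (t a)`, given as a family of bilinear maps. -/
structure TwistedPresheaf where
  /-- the sections over the open sets -/
  V : Q₀ → Opens X → Type u
  [addCommGroup : ∀ i U, AddCommGroup (V i U)]
  [module : ∀ i U, Module (SmoothFun d U) (V i U)]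
  /-- the restriction maps -/
  res : ∀ (i : Q₀) {U W : Opens X}, W ≤ U → V i U →+ V i W
  res_self : ∀ (i : Q₀) (U : Opens X) (v : V i U), res i le_rfl v = v
  res_res : ∀ (i : Q₀) {U W W' : Opens X} (h : W ≤ U) (h' : W' ≤ W) (v : V i U),
    res i h' (res i h v) = res i (h'.trans h) v
  res_smul : ∀ (i : Q₀) {U W : Opens X} (h : W ≤ U) (f : SmoothFun d U) (v : V i U),
    res i h (f • v) = resFun h f • res i h v
  /-- the maps of the arrows -/
  act : ∀ (a : Q₁) (U : Opens X),
    V (s a) U →ₗ[SmoothFun d U] Sec (M a) U →ₗ[SmoothFun d U] V (t a) U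
  res_act : ∀ (a : Q₁) {U W : Opens X} (h : W ≤ U) (v : V (s a) U) (m : Sec (M a) U),
    res (t a) h (act a U v m) = act a W (res (s a) h v) (resSec (M a) h m)

attribute [instance] TwistedPresheaf.addCommGroup TwistedPresheaf.module

namespace TwistedPresheaf

variable {s t M} (P : TwistedPresheaf s t M)

/-- The sections over `U` of the direct sum `⨁ i, V i`. -/
def Total (U : Opens X) : Type u := ∀ i, P.V i U

instance (U : Opens X) : AddCommGroup (P.Total U) := inferInstanceAs (AddCommGroup (∀ i, P.V i U))

/-- Restriction on the direct sum. -/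
def resTotal {U W : Opens X} (h : W ≤ U) : P.Total U →+ P.Total W where
  toFun v := fun i ↦ P.res i h (v i)
  map_zero' := funext fun i ↦ map_zero (P.res i h)
  map_add' v w := funext fun i ↦ map_add (P.res i h) (v i) (w i)

/-- The action of `𝒮(U)` on the direct sum, with `e_i` the projection to the summand `V i`. -/
def vertexAct (U : Opens X) : VertexRing d Q₀ U →+* AddMonoid.End (P.Total U) where
  toFun f :=
    { toFun := fun v i ↦ f i • v i
      map_zero' := funext fun i ↦ smul_zero (f i)
      map_add' := fun v w ↦ funext fun i ↦ smul_add (f i) (v i) (w i) }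
  map_one' := AddMonoidHom.ext fun v ↦ funext fun i ↦ one_smul (SmoothFun d U) (v i)
  map_mul' f g := AddMonoidHom.ext fun v ↦ funext fun i ↦ mul_smul (f i) (g i) (v i)
  map_zero' := AddMonoidHom.ext fun v ↦ funext fun i ↦ zero_smul (SmoothFun d U) (v i)
  map_add' f g := AddMonoidHom.ext fun v ↦ funext fun i ↦ add_smul (f i) (g i) (v i)

variable [Fintype Q₁]

open Classical in
/-- The action of `ℳ(U)` on the direct sum: `m ∈ M_a` takes `v` to the element of the summand at
`t(a)` that is the value of the map of the arrow `a` on `v_{s(a)} ⊗ m`. -/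
def arrowFun (U : Opens X) (m : ArrowModule s t M U) (v : P.Total U) : P.Total U :=
  ∑ a, (Pi.single (t a) (P.act a U (v (s a)) (m a)) : ∀ i, P.V i U)

theorem arrowFun_add (U : Opens X) (m : ArrowModule s t M U) (v w : P.Total U) :
    P.arrowFun U m (v + w) = P.arrowFun U m v + P.arrowFun U m w := by
  classical
  unfold arrowFun
  refine Eq.trans ?_ Finset.sum_add_distrib
  refine Finset.sum_congr rfl fun a _ ↦ ?_
  refine Eq.trans ?_ (Pi.single_add _ _ _)
  congr 1
  change P.act a U (v (s a) + w (s a)) (m a) = _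
  rw [map_add, LinearMap.add_apply]

theorem add_arrowFun (U : Opens X) (m m' : ArrowModule s t M U) (v : P.Total U) :
    P.arrowFun U (m + m') v = P.arrowFun U m v + P.arrowFun U m' v := by
  classical
  unfold arrowFun
  refine Eq.trans ?_ Finset.sum_add_distrib
  refine Finset.sum_congr rfl fun a _ ↦ ?_
  refine Eq.trans ?_ (Pi.single_add _ _ _)
  congr 1
  change P.act a U (v (s a)) (m a + m' a) = _
  rw [map_add]

theorem smul_arrowFun (U : Opens X) (f : VertexRing d Q₀ U) (m : ArrowModule s t M U)
    (v : P.Total U) : P.arrowFun U (f • m) v = P.vertexAct U f (P.arrowFun U m v) := by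
  classical
  unfold arrowFun
  refine Eq.trans ?_ (map_sum (P.vertexAct U f) _ _).symm
  refine Finset.sum_congr rfl fun a _ ↦ ?_
  funext i
  change (Pi.single (t a) (P.act a U (v (s a)) (f (t a) • m a)) : ∀ i, P.V i U) i =
    f i • (Pi.single (t a) (P.act a U (v (s a)) (m a)) : ∀ i, P.V i U) i
  rw [map_smul]
  by_cases hi : i = t a
  · subst hi; simp
  · simp [hi]

theorem op_smul_arrowFun (U : Opens X) (f : VertexRing d Q₀ U) (m : ArrowModule s t M U)
    (v : P.Total U) :
    P.arrowFun U (MulOpposite.op f • m) v = P.arrowFun U m (P.vertexAct U f v) := by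
  classical
  unfold arrowFun
  refine Finset.sum_congr rfl fun a _ ↦ ?_
  congr 1
  change P.act a U (v (s a)) (f (s a) • m a) = P.act a U (f (s a) • v (s a)) (m a)
  rw [map_smul, map_smul, LinearMap.smul_apply]

theorem res_arrowFun {U W : Opens X} (h : W ≤ U) (m : ArrowModule s t M U) (v : P.Total U) :
    P.resTotal h (P.arrowFun U m v) = P.arrowFun W (resArrow s t M h m) (P.resTotal h v) := by
  classical
  unfold arrowFun
  refine (map_sum (P.resTotal h) _ _).trans ?_
  refine Finset.sum_congr rfl fun a _ ↦ ?_
  funext i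
  change P.res i h ((Pi.single (t a) (P.act a U (v (s a)) (m a)) : ∀ i, P.V i U) i) =
    (Pi.single (t a) (P.act a W (P.res (s a) h (v (s a))) (resSec (M a) h (m a))) :
      ∀ i, P.V i W) i
  rw [← P.res_act]
  by_cases hi : i = t a
  · subst hi; simp
  · simp [hi]

/-- The ring homomorphism `T_{𝒮(U)}(ℳ(U)) → End (⨁ i, V i U)`. -/
def pathAct (U : Opens X) : PathAlg s t M U →+* AddMonoid.End (P.Total U) :=
  BimoduleTensorAlgebra.lift (P.vertexAct U)
    (AddMonoidHom.mk' (fun m ↦ AddMonoidHom.mk' (P.arrowFun U m) (P.arrowFun_add U m))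
      (fun m m' ↦ AddMonoidHom.ext fun v ↦ P.add_arrowFun U m m' v))
    (fun f m ↦ AddMonoidHom.ext fun v ↦ P.smul_arrowFun U f m v)
    (fun f m ↦ AddMonoidHom.ext fun v ↦ P.op_smul_arrowFun U f m v)

instance (U : Opens X) : Module (PathAlg s t M U) (P.Total U) :=
  Module.compHom (P.Total U) (P.pathAct U)

theorem scalar_smul (U : Opens X) (f : VertexRing d Q₀ U) (v : P.Total U) :
    (BimoduleTensorAlgebra.scalar f : PathAlg s t M U) • v = P.vertexAct U f v :=
  DFunLike.congr_fun (BimoduleTensorAlgebra.lift_scalar (P.vertexAct U) _ _ _ f) v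

theorem vector_smul (U : Opens X) (m : ArrowModule s t M U) (v : P.Total U) :
    (BimoduleTensorAlgebra.vector m : PathAlg s t M U) • v = P.arrowFun U m v :=
  DFunLike.congr_fun (BimoduleTensorAlgebra.lift_vector (P.vertexAct U) _ _ _ m) v

/-- The presheaf of abelian groups `⨁ i, V i`. -/
def totalPresheaf : (Opens X)ᵒᵖ ⥤ Ab.{u} where
  obj U := AddCommGrpCat.of (P.Total U.unop)
  map f := AddCommGrpCat.ofHom (P.resTotal f.unop.le)
  map_id U := by
    ext v
    exact funext fun i ↦ P.res_self i _ (v i)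
  map_comp f g := by
    ext v
    exact funext fun i ↦ (P.res_res i f.unop.le g.unop.le (v i)).symm

instance (U : (Opens X)ᵒᵖ) :
    Module ((pathPresheaf s t M).obj U) (P.totalPresheaf.obj U) :=
  inferInstanceAs (Module (PathAlg s t M U.unop) (P.Total U.unop))

/-- The presheaf of left modules over `U ↦ T_{𝒮(U)}(ℳ(U))` with underlying presheaf
`⨁ i, V i`. -/
def presheafModule : PresheafOfModules.{u} (pathPresheaf s t M) :=
  PresheafOfModules.ofPresheaf P.totalPresheaf fun U W f x v ↦
    BimoduleTensorAlgebra.smul_compat (resPath s t M f.unop.le) (P.resTotal f.unop.le)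
      (fun r v ↦ by
        rw [resPath_scalar, scalar_smul, scalar_smul]
        exact funext fun i ↦ P.res_smul i _ (r i) (v i))
      (fun m v ↦ by
        rw [resPath_vector, vector_smul, vector_smul, res_arrowFun])
      x v

/-- The sheaf of `𝒜`-modules associated with a twisted representation. -/
def sheafModule : PathMod s t M :=
  (PresheafOfModules.sheafification.{u} (toPathSheaf s t M)).obj P.presheafModule

/-- A morphism of twisted representations: natural linear maps that commute with the maps of the
arrows. -/
structure Hom (P P' : TwistedPresheaf s t M) where
  /-- the maps on sections -/
  app : ∀ (i : Q₀) (U : Opens X), P.V i U →ₗ[SmoothFun d U] P'.V i U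
  naturality : ∀ (i : Q₀) {U W : Opens X} (h : W ≤ U) (v : P.V i U),
    P'.res i h (app i U v) = app i W (P.res i h v)
  app_act : ∀ (a : Q₁) (U : Opens X) (v : P.V (s a) U) (m : Sec (M a) U),
    app (t a) U (P.act a U v m) = P'.act a U (app (s a) U v) m

variable {P} {P' : TwistedPresheaf s t M}

/-- The map on the direct sums. -/
def Hom.total (k : P.Hom P') (U : Opens X) : P.Total U →+ P'.Total U where
  toFun v := fun i ↦ k.app i U (v i)
  map_zero' := funext fun i ↦ map_zero (k.app i U)
  map_add' v w := funext fun i ↦ map_add (k.app i U) (v i) (w i)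

theorem Hom.total_smul (k : P.Hom P') (U : Opens X) (x : PathAlg s t M U) (v : P.Total U) :
    k.total U (x • v) = x • k.total U v := by
  refine BimoduleTensorAlgebra.smul_compat (RingHom.id (PathAlg s t M U)) (k.total U)
    (fun r v ↦ ?_) (fun m v ↦ ?_) x v
  · rw [RingHom.id_apply, scalar_smul, scalar_smul]
    exact funext fun i ↦ map_smul (k.app i U) (r i) (v i)
  · rw [RingHom.id_apply, vector_smul, vector_smul]
    classical
    unfold arrowFun
    refine (map_sum (k.total U) _ _).trans ?_
    refine Finset.sum_congr rfl fun a _ ↦ ?_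
    funext i
    change k.app i U ((Pi.single (t a) (P.act a U (v (s a)) (m a)) : ∀ i, P.V i U) i) =
      (Pi.single (t a) (P'.act a U (k.app (s a) U (v (s a))) (m a)) : ∀ i, P'.V i U) i
    rw [← k.app_act]
    by_cases hi : i = t a
    · subst hi; simp
    · simp [hi]

/-- The morphism of presheaves of modules. -/
def Hom.presheafHom (k : P.Hom P') : P.presheafModule ⟶ P'.presheafModule :=
  PresheafOfModules.homMk
    { app := fun U ↦ AddCommGrpCat.ofHom (k.total U.unop)
      naturality := fun U W f ↦ by
        ext v
        exact funext fun i ↦ (k.naturality i f.unop.le (v i)).symm }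
    (fun U x v ↦ k.total_smul U.unop x v)

end TwistedPresheaf

end PathAlgebra

section Extension

variable {d : ℕ} {X : Type u} [TopologicalSpace X] [ChartedSpace (EuclideanSpace ℝ (Fin d)) X]
  [IsManifold (𝓡 d) ∞ X] {Q₀ Q₁ : Type u} {s t : Q₁ → Q₀} {M : Q₁ → SmoothVB d X}

/-- The bilinear map `(w, v), n ↦ (p (w, n) + g (v, n), q (v, n))`. -/
def blockAct {A W V N W' V' : Type u} [CommRing A] [AddCommGroup W] [Module A W] [AddCommGroup V]
    [Module A V] [AddCommGroup N] [Module A N] [AddCommGroup W'] [Module A W'] [AddCommGroup V']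
    [Module A V'] (p : W →ₗ[A] N →ₗ[A] W') (g : V →ₗ[A] N →ₗ[A] W') (q : V →ₗ[A] N →ₗ[A] V') :
    W × V →ₗ[A] N →ₗ[A] W' × V' :=
  LinearMap.mk₂ A (fun x n ↦ (p x.1 n + g x.2 n, q x.2 n))
    (fun x y n ↦ Prod.ext (by simp; abel) (by simp))
    (fun f x n ↦ Prod.ext (by simp) (by simp))
    (fun x n n' ↦ Prod.ext (by simp; abel) (by simp))
    (fun f x n ↦ Prod.ext (by simp) (by simp))

/-- An `M`-twisted quiver bundle: a vector bundle `E i` for every vertex and a morphism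
`E (s a) ⊗ M_a → E (t a)` for every arrow. -/
structure TwistedBundle (s t : Q₁ → Q₀) (M : Q₁ → SmoothVB d X) where
  /-- the bundles at the vertices -/
  E : Q₀ → SmoothVB d X
  /-- the morphisms at the arrows -/
  φ : ∀ a : Q₁, TensorHom (E (s a)) (M a) (E (t a))

namespace TwistedBundle

/-- The twisted quiver bundle `T_X^* ⊗ R`. -/
def form (R : TwistedBundle s t M) : TwistedBundle s t M where
  E i := formBundle (R.E i)
  φ a := (R.φ a).formLeft

/-- The twisted representation in sheaves of `C^∞`-modules given by the sheaves of sections. -/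
def toPresheaf (R : TwistedBundle s t M) : TwistedPresheaf s t M where
  V i U := Sec (R.E i) U
  res i _ _ h := resSec (R.E i) h
  res_self _ _ _ := rfl
  res_res _ _ _ _ _ _ _ := rfl
  res_smul _ _ _ _ _ _ := rfl
  act a U := (R.φ a).toSheaf.map U
  res_act a _ _ h v m := (R.φ a).toSheaf.naturality h v m

variable (R : TwistedBundle s t M)

/-- The family of defects `β_a = (id ⊗ φ_a) ∘ (∇_{s(a)} ⊗ ∇_a) - ∇_{t(a)} ∘ φ_a`. -/
def defects [T2Space X] (DM : ∀ a, SmoothConnection (M a)) (D : ∀ i, SmoothConnection (R.E i))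
    (a : Q₁) : SheafTensorHom (R.E (s a)) (M a) (formBundle (R.E (t a))) :=
  defect (R.φ a) (D (s a)) (DM a) (D (t a))

/-- A smooth relative connection on a twisted quiver bundle: connections on the bundles at the
vertices and on the twisting bundles such that every `φ_a` is compatible with them. -/
structure RelativeConnection [T2Space X] where
  /-- the connections on the bundles at the vertices -/
  vertex : ∀ i, SmoothConnection (R.E i)
  /-- the induced connections on the twisting bundles -/
  arrow : ∀ a, SmoothConnection (M a)
  compatible : ∀ a, Compatible (R.φ a) (vertex (s a)) (arrow a) (vertex (t a))

variable (γ : ∀ a, SheafTensorHom (R.E (s a)) (M a) (formBundle (R.E (t a))))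

/-- The twisted representation on `(T_X^* ⊗ E i) ⊕ E i` in which the arrow `a` acts by
`(η, e) ⊗ m ↦ ((id ⊗ φ_a) (η ⊗ m) + γ_a (e ⊗ m), φ_a (e ⊗ m))`. -/
def extension : TwistedPresheaf s t M where
  V i U := Sec (formBundle (R.E i)) U × Sec (R.E i) U
  res i _ _ h := (resSec (formBundle (R.E i)) h).prodMap (resSec (R.E i) h)
  res_self _ _ _ := rfl
  res_res _ _ _ _ _ _ _ := rfl
  res_smul _ _ _ _ _ _ := rfl
  act a U := blockAct ((R.φ a).formLeft.toSheaf.map U) ((γ a).map U) ((R.φ a).toSheaf.map U)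
  res_act a U W h p m := by
    refine Prod.ext ?_ ?_
    · change resSec (formBundle (R.E (t a))) h
        ((R.φ a).formLeft.toSheaf.map U p.1 m + (γ a).map U p.2 m) = _
      rw [AddMonoidHom.map_add, SheafTensorHom.naturality, SheafTensorHom.naturality]
      rfl
    · exact (R.φ a).toSheaf.naturality h p.2 m

/-- The inclusion of `T_X^* ⊗ R` in the extension. -/
def extensionIncl : R.form.toPresheaf.Hom (R.extension γ) where
  app i U := LinearMap.inl (SmoothFun d U) (Sec (formBundle (R.E i)) U) (Sec (R.E i) U)
  naturality i U W h v := Prod.ext rfl (map_zero (resSec (R.E i) h))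
  app_act a U v m := by
    refine Prod.ext ?_ ?_
    · change (R.φ a).formLeft.toSheaf.map U v m =
        (R.φ a).formLeft.toSheaf.map U v m + (γ a).map U 0 m
      rw [LinearMap.map_zero, LinearMap.zero_apply, add_zero]
    · change (0 : Sec (R.E (t a)) U) = (R.φ a).toSheaf.map U 0 m
      rw [LinearMap.map_zero, LinearMap.zero_apply]

/-- The projection of the extension to `R`. -/
def extensionProj : (R.extension γ).Hom R.toPresheaf where
  app i U := LinearMap.snd (SmoothFun d U) (Sec (formBundle (R.E i)) U) (Sec (R.E i) U)
  naturality _ _ _ _ _ := rfl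
  app_act _ _ _ _ := rfl

variable [Fintype Q₁]

/-- The sequence `T_X^* ⊗ R → extension → R` of presheaves of modules. -/
def presheafSeq : ShortComplex (PresheafOfModules.{u} (pathPresheaf s t M)) :=
  ShortComplex.mk (R.extensionIncl γ).presheafHom (R.extensionProj γ).presheafHom rfl

/-- Without the module structures the sequence is split. -/
def presheafSeqSplitting :
    ((R.presheafSeq γ).map (PresheafOfModules.toPresheaf.{u} (pathPresheaf s t M))).Splitting where
  r :=
    { app := fun U ↦ AddCommGrpCat.ofHom
        (show (R.extension γ).Total U.unop →+ R.form.toPresheaf.Total U.unop from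
          { toFun := fun v i ↦ (v i).1
            map_zero' := rfl
            map_add' := fun _ _ ↦ rfl })
      naturality := fun _ _ _ ↦ rfl }
  s :=
    { app := fun U ↦ AddCommGrpCat.ofHom
        (show R.toPresheaf.Total U.unop →+ (R.extension γ).Total U.unop from
          { toFun := fun v i ↦ ((0 : Sec (formBundle (R.E i)) U.unop), v i)
            map_zero' := rfl
            map_add' := fun v w ↦ funext fun i ↦
              Prod.ext (add_zero (0 : Sec (formBundle (R.E i)) U.unop)).symm rfl })
      naturality := fun U W f ↦ by
        ext v
        exact funext fun i ↦ Prod.ext (map_zero (resSec (formBundle (R.E i)) f.unop.le)).symm rfl }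
  f_r := rfl
  s_g := rfl
  id := by
    ext U v
    refine funext fun i ↦ Prod.ext ?_ ?_
    · exact add_zero (v i).1
    · exact zero_add (v i).2

theorem presheafSeq_shortExact : (R.presheafSeq γ).ShortExact := by
  have h := (R.presheafSeqSplitting γ).shortExact
  have hm := h.mono_f
  have he := h.epi_g
  exact
    { exact := (ShortComplex.exact_map_iff_of_faithful _ _).1 h.exact
      mono_f := (PresheafOfModules.toPresheaf.{u} (pathPresheaf s t M)).mono_of_mono_map hm
      epi_g := (PresheafOfModules.toPresheaf.{u} (pathPresheaf s t M)).epi_of_epi_map he }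

/-- The sheaf of `𝒜`-modules `⨁ i, E i` of a twisted quiver bundle. -/
def sheafModule : PathMod s t M := R.toPresheaf.sheafModule

/-- The sequence `0 → T_X^* ⊗ R → extension → R → 0` of sheaves of `𝒜`-modules. -/
def sheafSeq : ShortComplex (PathMod s t M) :=
  (R.presheafSeq γ).map (PresheafOfModules.sheafification.{u} (toPathSheaf s t M))

theorem sheafSeq_shortExact : (R.sheafSeq γ).ShortExact :=
  (R.presheafSeq_shortExact γ).map_of_exact
    (PresheafOfModules.sheafification.{u} (toPathSheaf s t M))

/-- The canonical map `⨁ a, Hom(E_{s(a)} ⊗ M_a, T_X^* ⊗ E_{t(a)}) → Ext¹_𝒜(R, T_X^* ⊗ R)`: it takes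
`{γ_a}` to the class of the extension of `R` by `T_X^* ⊗ R` in which the arrow `a` acts by the
block matrix with diagonal entries `id ⊗ φ_a`, `φ_a` and off-diagonal entry `γ_a`. -/
def toExt : Abelian.Ext.{u + 1} R.sheafModule R.form.sheafModule 1 :=
  (R.sheafSeq_shortExact γ).extClass

end TwistedBundle

end Extension

end

end QuiverBundle

/-! Connections on `E i` form an affine space over the homomorphisms of sheaves of modules `α_i :
E_i → T_X^* ⊗ E_i`. Substituting `∇_i = ∇⁰_i + α_i` in the compatibility condition for the arrow
`a`, with the connection on `M_a` fixed, the contribution of `∇_a` is the same on both sides and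
there remains `α_{t(a)} ∘ φ_a - (id ⊗ φ_a) ∘ (α_{s(a)} ⊗ id) = β_a`. A family `α` that solves this
system is a `Primitive` of `β`, and `exists_relativeConnection_iff` identifies relative connections
inducing the given `∇_a` with primitives.

The same system describes splittings of the extension defined by any family `γ`. A retraction onto
`T_X^* ⊗ R` which respects the vertices has the form `(η, e) ↦ η - α e`, and it commutes with the
arrows exactly when `α` is a primitive of `γ`. Since an extension class vanishes if and only if the
sequence splits (`extClass_eq_zero_iff`), this gives `toExt_eq_zero_iff_nonempty_primitive`, and the
theorem is the case `γ = β`.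

Two points need work. The Ext group lives over the sheafified path algebra, where sections are hard
to handle. A retraction of sheaves is therefore moved by the sheafification adjunction to presheaves
of modules over `U ↦ T_{𝒮(U)}(ℳ(U))` (`toExt_eq_zero_iff_presheaf`); this is possible because the
sections of `T_X^* ⊗ R` already form a sheaf. Secondly, a covariant derivative acts on sections over
all of `X` and is changed by a form with values in fibrewise linear maps, whereas `α` acts on local
sections; `apply_eq_fiberMap` passes from one to the other by local frames. -/

/-! ### Splittings: extension classes and retractions along an adjunction. -/

/-- The class of a short exact sequence vanishes if and only if the sequence splits. -/
theorem CategoryTheory.ShortComplex.ShortExact.extClass_eq_zero_iff {C : Type*} [Category* C]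
    [Abelian C] [HasExt C] {S : ShortComplex C} (hS : S.ShortExact) :
    hS.extClass = 0 ↔ ∃ r : S.X₂ ⟶ S.X₁, S.f ≫ r = 𝟙 S.X₁ := by
  constructor
  · intro h
    -- In the exact sequence `Hom(X₂, X₁) → Hom(X₁, X₁) → Ext¹(X₃, X₁)` the identity of `X₁` goes to
    -- the extension class, so when the class is zero the identity lifts to a retraction.
    obtain ⟨x, hx⟩ := Abelian.Ext.contravariant_sequence_exact₁ hS _
      (Abelian.Ext.mk₀ (𝟙 S.X₁)) (add_zero 1) (by rw [h, Abelian.Ext.zero_comp])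
    obtain ⟨r, rfl⟩ := Abelian.Ext.homEquiv₀.symm.surjective x
    refine ⟨r, Abelian.Ext.homEquiv₀.symm.injective ?_⟩
    simpa using hx
  · rintro ⟨r, hr⟩
    -- The class is always killed by composition with `S.f`, hence by composition with `S.f ≫ r`,
    -- which is the identity.
    have h := hS.extClass_comp_assoc (Abelian.Ext.mk₀ r) (h := add_zero 1)
    rwa [Abelian.Ext.mk₀_comp_mk₀, hr, Abelian.Ext.comp_mk₀_id] at h

/-- If the unit of an adjunction is an isomorphism at `Y`, a morphism `Y ⟶ Z` has a left inverse as
soon as its image under the left adjoint has one. -/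
theorem CategoryTheory.Adjunction.exists_retraction_of_map {C D : Type*} [Category* C] [Category* D]
    {F : C ⥤ D} {G : D ⥤ C} (adj : F ⊣ G) {Y Z : C} [IsIso (adj.unit.app Y)] (f : Y ⟶ Z)
    (r : F.obj Z ⟶ F.obj Y) (hr : F.map f ≫ r = 𝟙 _) : ∃ ρ : Z ⟶ Y, f ≫ ρ = 𝟙 Y := by
  -- The transpose of `r` ends in `G (F Y)`. Precomposed with `f` it is the transpose of the
  -- identity, which is the unit at `Y`.
  refine ⟨adj.homEquiv _ _ r ≫ inv (adj.unit.app Y), ?_⟩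
  rw [← Category.assoc, ← adj.homEquiv_naturality_left, hr, adj.homEquiv_id, IsIso.hom_inv_id]

namespace QuiverBundle

noncomputable section

variable {d : ℕ} {X : Type u} [TopologicalSpace X] [ChartedSpace (EuclideanSpace ℝ (Fin d)) X]

/-! ### Local frames, and sheaf homomorphisms as fibrewise linear maps. -/

/-- The local frame of `E` over an open set containing `x` given by the preferred trivialization
at `x`. -/
abbrev frameAt (E : SmoothVB d X) (x : X) (i : Fin (Module.finrank ℝ E.Model)) (y : X) :
    E.Fiber y :=
  (trivializationAt E.Model E.Fiber x).localFrame (Module.finBasis ℝ E.Model) i y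

/-- The base set of the preferred trivialization at `x`. -/
def frameDomain (E : SmoothVB d X) (x : X) : Opens X :=
  ⟨(trivializationAt E.Model E.Fiber x).baseSet, (trivializationAt E.Model E.Fiber x).open_baseSet⟩

theorem mem_frameDomain (E : SmoothVB d X) (x : X) : x ∈ frameDomain E x :=
  FiberBundle.mem_baseSet_trivializationAt' x

/-- The sections of the local frame at `x`. -/
def frameSec (E : SmoothVB d X) (x : X) (i : Fin (Module.finrank ℝ E.Model)) :
    Sec E (frameDomain E x) :=
  Sec.mk (fun y ↦ frameAt E x i y) ((isSmoothSec_restrict_iff E _).2 fun _ hy ↦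
    contMDiffAt_localFrame_of_mem (I := 𝓡 d) ∞ (trivializationAt E.Model E.Fiber x)
      (Module.finBasis ℝ E.Model) i hy)

/-- The coordinates at `x` with respect to the local frame at `x`. -/
def frameCoord (E : SmoothVB d X) (x : X) (i : Fin (Module.finrank ℝ E.Model)) :
    E.Fiber x →L[ℝ] ℝ :=
  (LinearMap.toContinuousLinearMap ((Module.finBasis ℝ E.Model).coord i)).comp
    ((trivializationAt E.Model E.Fiber x).continuousLinearMapAt ℝ x)

/-- The functional `frameCoord` lives on the single fibre over the centre `x`, while
`localFrameCoeff` gives coefficients that vary smoothly near `x`. Their agreement at the centre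
allows a frame expansion to be evaluated there. -/
theorem frameCoord_apply (E : SmoothVB d X) (x : X) (i : Fin (Module.finrank ℝ E.Model))
    (σ : ∀ y, E.Fiber y) : frameCoord E x i (σ x) =
      (trivializationAt E.Model E.Fiber x).localFrameCoeff (𝓡 d) (Module.finBasis ℝ E.Model)
        i x (σ x) := by
  have hx : x ∈ (trivializationAt E.Model E.Fiber x).baseSet :=
    FiberBundle.mem_baseSet_trivializationAt' x
  rw [(trivializationAt E.Model E.Fiber x).localFrameCoeff_apply_of_mem_baseSet (I := 𝓡 d)
    (Module.finBasis ℝ E.Model) hx]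
  simp [frameCoord, Trivialization.basisAt, hx]

section FiberMap

variable {E E' : SmoothVB d X} (α : ∀ U : Opens X, Sec E U →ₗ[SmoothFun d U] Sec E' U)

/-- The linear maps on the fibres underlying a family of linear maps on local sections. -/
def fiberMap (x : X) : E.Fiber x →L[ℝ] E'.Fiber x :=
  ∑ i, (frameCoord E x i).smulRight ((α (frameDomain E x) (frameSec E x i)).1
    ⟨x, mem_frameDomain E x⟩)

/-- A homomorphism of sheaves of modules between vector bundles is given by linear maps on the
fibres. -/
theorem apply_eq_fiberMap (hα : ∀ {U V : Opens X} (h : V ≤ U) (σ : Sec E U),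
    resSec E' h (α U σ) = α V (resSec E h σ)) {U : Opens X} (σ : Sec E U) (x : U) :
    (α U σ).1 x = fiberMap α x (σ.1 x) := by
  let e := trivializationAt E.Model E.Fiber (x : X)
  let b := Module.finBasis ℝ E.Model
  let V : Opens X := U ⊓ frameDomain E x
  have hV : V ≤ U := inf_le_left
  have hW : V ≤ frameDomain E x := inf_le_right
  -- The coefficients of `σ` in the frame are smooth on `V`, so `σ` is a combination of frame
  -- sections over `C^∞(V)`. Linearity of `α V` then shows that the value of `α σ` at `x` depends
  -- only on the coordinates of `σ x`.
  let f (i : Fin (Module.finrank ℝ E.Model)) : SmoothFun d V :=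
    ⟨fun y ↦ e.localFrameCoeff (𝓡 d) b i y (extZero E σ.1 y), fun y ↦
      contMDiffAt_subtype_iff.2 (contMDiffAt_localFrameCoeff b (hW y.2)
        ((isSmoothSec_iff E σ.1).1 σ.2 y (hV y.2)) i)⟩
  have hσ : resSec E hV σ = ∑ i, f i • resSec E hW (frameSec E x i) := by
    refine Subtype.ext (funext fun y ↦ ?_)
    have h := Trivialization.eq_sum_localFrameCoeff_smul (I := 𝓡 d) (e := e) (b := b) (s := extZero E σ.1) (hW y.2)
    rw [extZero_of_mem E _ (hV y.2)] at h
    refine h.trans ?_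
    rw [AddSubgroup.val_finsetSum, Finset.sum_apply]
    refine Finset.sum_congr rfl fun i _ ↦ ?_
    rw [← extZero_of_mem E σ.1 (hV y.2)]
    rfl
  have hx : (x : X) ∈ V := ⟨x.2, mem_frameDomain E x⟩
  have h := congrArg (fun τ : Sec E' V ↦ τ.1 ⟨x, hx⟩) (hα hV σ)
  rw [hσ, map_sum] at h
  refine h.trans ?_
  dsimp only
  rw [AddSubgroup.val_finsetSum, Finset.sum_apply, fiberMap, _root_.sum_apply]
  refine Finset.sum_congr rfl fun i _ ↦ ?_
  rw [map_smul, smul_coe, ← hα hW, ContinuousLinearMap.smulRight_apply, ← extZero_coe E σ.1 x,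
    frameCoord_apply]
  rfl

end FiberMap

/-! ### The affine space of connections on a vector bundle. -/

section Connection

variable [IsManifold (𝓡 d) ∞ X] {E : SmoothVB d X}

/-- The sum of a connection and an endomorphism-valued one-form, the latter given as a homomorphism
of sheaves of modules `E → T_X^* ⊗ E`. -/
def SmoothConnection.addForm (D : SmoothConnection E)
    (α : ∀ U : Opens X, Sec E U →ₗ[SmoothFun d U] Sec (formBundle E) U)
    (hα : ∀ {U V : Opens X} (h : V ≤ U) (σ : Sec E U),
      resSec (formBundle E) h (α U σ) = α V (resSec E h σ)) : SmoothConnection E where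
  cov := ⟨fun σ x ↦ D.cov σ x + fiberMap α x (σ x),
    D.cov.isCovariantDerivativeOnUniv.add_one_form (fiberMap α)⟩
  smooth := ⟨⟨fun {σ} hσ ↦ by
    refine (D.smooth.contMDiff.contMDiff hσ).add_section fun x _ ↦ ?_
    -- Each `fiberMap α x` is built from the frame centred at `x`, so smooth dependence on `x` is
    -- not visible from its definition. It follows because the section obtained from `σ` equals `α ⊤
    -- σ`, which is smooth by assumption.
    have hs : IsSmoothSec E ⊤ (fun x : (⊤ : Opens X) ↦ σ x) :=
      (isSmoothSec_restrict_iff E σ).2 fun y _ ↦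
        (hσ y (Set.mem_univ y)).contMDiffAt Filter.univ_mem
    have h := (isSmoothSec_restrict_iff (formBundle E) (fun x ↦ fiberMap α x (σ x))
      (U := ⊤)).1
    refine (h ?_ x trivial).contMDiffWithinAt
    have he : (fun x : (⊤ : Opens X) ↦ fiberMap α (x : X) (σ x)) = (α ⊤ (Sec.mk _ hs)).1 :=
      funext fun y ↦ (apply_eq_fiberMap α hα (Sec.mk _ hs) y).symm
    rw [he]
    exact (α ⊤ (Sec.mk _ hs)).2⟩⟩

variable [T2Space X]

/-- On a local section `nabla` is computed from the extension by zero. The added term sees only the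
value at `x`, which the extension does not change. -/
theorem SmoothConnection.addForm_nabla (D : SmoothConnection E)
    (α : ∀ U : Opens X, Sec E U →ₗ[SmoothFun d U] Sec (formBundle E) U)
    (hα : ∀ {U V : Opens X} (h : V ≤ U) (σ : Sec E U),
      resSec (formBundle E) h (α U σ) = α V (resSec E h σ)) {U : Opens X} (σ : Sec E U) :
    (D.addForm α hα).nabla σ = D.nabla σ + α U σ := by
  refine Subtype.ext (funext fun x ↦ ?_)
  rw [add_sec_apply, apply_eq_fiberMap α hα, ← extZero_coe E σ.1 x]
  rfl

/-- The difference of two connections, as a homomorphism of sheaves of modules. -/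
def SmoothConnection.difference (D D' : SmoothConnection E) (U : Opens X) :
    Sec E U →ₗ[SmoothFun d U] Sec (formBundle E) U where
  toFun σ := D.nabla σ - D'.nabla σ
  map_add' σ τ := by rw [nabla_add, nabla_add]; abel
  map_smul' f σ := formSec_ext fun x v ↦ by
    -- Both connections produce the same Leibniz term `df ⊗ σ`, which cancels in the difference.
    rw [RingHom.id_apply, formVal_smul, map_sub, map_sub, nabla_smul_apply, nabla_smul_apply]
    module

theorem SmoothConnection.difference_apply (D D' : SmoothConnection E) {U : Opens X}
    (σ : Sec E U) : D.difference D' U σ = D.nabla σ - D'.nabla σ := rfl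

theorem SmoothConnection.difference_res (D D' : SmoothConnection E) {U V : Opens X} (h : V ≤ U)
    (σ : Sec E U) :
    resSec (formBundle E) h (D.difference D' U σ) = D.difference D' V (resSec E h σ) := by
  rw [difference_apply, difference_apply, (resSec (formBundle E) h).map_sub, nabla_res, nabla_res]

end Connection

/-! ### Gluing of smooth sections. -/

/-- Sections of a vector bundle can be glued. -/
theorem existsUnique_gluing_sec (E : SmoothVB d X) {ι : Type*} (U : ι → Opens X)
    (σ : ∀ j, Sec E (U j))
    (hσ : ∀ j k, resSec E (inf_le_left : U j ⊓ U k ≤ U j) (σ j) = resSec E inf_le_right (σ k)) :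
    ∃! τ : Sec E (iSup U), ∀ j, resSec E (le_iSup U j) τ = σ j := by
  have hx (x : (iSup U : Opens X)) : ∃ j, (x : X) ∈ U j := Opens.mem_iSup.1 x.2
  choose c hc using hx
  -- The glued value at a point does not depend on the chosen member of the cover. Near a point of
  -- `U j` the glued section is therefore `σ j`, which gives smoothness.
  have key (j) (x : U j) : (σ (c ⟨x, le_iSup U j x.2⟩)).1 ⟨x, hc ⟨x, le_iSup U j x.2⟩⟩ =
      (σ j).1 x :=
    congrArg (fun τ ↦ τ.1 ⟨x, ⟨hc ⟨x, le_iSup U j x.2⟩, x.2⟩⟩)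
      (hσ (c ⟨x, le_iSup U j x.2⟩) j)
  refine ⟨Sec.mk (fun x ↦ (σ (c x)).1 ⟨x, hc x⟩) ?_, fun j ↦ Subtype.ext (funext (key j)), ?_⟩
  · rw [isSmoothSec_iff]
    intro x hx
    obtain ⟨j, hj⟩ := Opens.mem_iSup.1 hx
    refine ((isSmoothSec_iff E _).1 (σ j).2 x hj).congr_of_eventuallyEq ?_
    filter_upwards [(U j).2.mem_nhds hj] with y hy
    rw [extZero_of_mem E _ (le_iSup U j hy), extZero_of_mem E _ hy]
    exact congrArg (TotalSpace.mk' E.Model y) (key j ⟨y, hy⟩)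
  · intro τ hτ
    refine Subtype.ext (funext fun x ↦ ?_)
    exact congrArg (fun τ ↦ τ.1 ⟨x, hc x⟩) (hτ (c x))

variable {Q₀ Q₁ : Type u} {s t : Q₁ → Q₀} {M : Q₁ → SmoothVB d X}

/-! ### From linear maps over the path algebra to morphisms of twisted representations. -/

namespace TwistedPresheaf

variable (P : TwistedPresheaf s t M)

open Classical in
/-- The inclusion of the summand `V i` in the direct sum. -/
def single (i : Q₀) (U : Opens X) : P.V i U →+ P.Total U := AddMonoidHom.single (P.V · U) i

/-- The projection of the direct sum to the summand `V i`. -/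
def proj (i : Q₀) (U : Opens X) : P.Total U →+ P.V i U where
  toFun v := v i
  map_zero' := rfl
  map_add' _ _ := rfl

theorem proj_single (i : Q₀) (U : Opens X) (v : P.V i U) : P.proj i U (P.single i U v) = v := by
  classical
  exact Pi.single_eq_same (M := (P.V · U)) i v

theorem proj_resTotal (i : Q₀) {U W : Opens X} (h : W ≤ U) (v : P.Total U) :
    P.proj i W (P.resTotal h v) = P.res i h (P.proj i U v) := rfl

theorem resTotal_single (i : Q₀) {U W : Opens X} (h : W ≤ U) (v : P.V i U) :
    P.resTotal h (P.single i U v) = P.single i W (P.res i h v) := by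
  classical
  funext j
  exact Pi.apply_single (fun i ↦ P.res i h) (fun i ↦ map_zero (P.res i h)) i v j

variable (s t M) in
open Classical in
/-- The inclusion of the summand `M_a` in `ℳ(U)`. -/
def arrowSingle (a : Q₁) (U : Opens X) (m : Sec (M a) U) : ArrowModule s t M U :=
  Pi.single (M := fun b ↦ Sec (M b) U) a m

theorem Hom.total_single {P P' : TwistedPresheaf s t M} (k : P.Hom P') (i : Q₀) (U : Opens X) (v : P.V i U) :
    k.total U (P.single i U v) = P'.single i U (k.app i U v) := by
  classical
  funext j
  exact Pi.apply_single (fun i ↦ k.app i U) (fun i ↦ map_zero (k.app i U)) i v j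

variable [Fintype Q₁]

/-- An element of the single summand `M_a` reads only the component at `s a` and writes only the
component at `t a`. This is what isolates one arrow in a linearity relation over the path algebra.
-/
theorem arrowFun_arrowSingle (U : Opens X) (a : Q₁) (m : Sec (M a) U) (v : P.Total U) :
    P.arrowFun U (arrowSingle s t M a U m) v =
      P.single (t a) U (P.act a U (P.proj (s a) U v) m) := by
  classical
  have hs (b : Q₁) (hb : b ≠ a) : arrowSingle s t M a U m b = 0 :=
    Pi.single_eq_of_ne (M := fun b ↦ Sec (M b) U) hb m
  have hs' : arrowSingle s t M a U m a = m := Pi.single_eq_same (M := fun b ↦ Sec (M b) U) a m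
  refine (Finset.sum_eq_single a (fun b _ hb ↦ ?_) (fun h ↦ absurd (Finset.mem_univ a) h)).trans ?_
  · rw [hs b hb, LinearMap.map_zero]
    exact Pi.single_zero (M := (P.V · U)) (t b)
  · rw [hs']
    rfl

/-- The constant family with value `f` embeds `C^∞(U)` in the path algebra; its action gives
linearity over smooth functions. -/
theorem scalar_smul_single (U : Opens X) (i : Q₀) (f : SmoothFun d U) (v : P.V i U) :
    (BimoduleTensorAlgebra.scalar (fun _ ↦ f) : PathAlg s t M U) • P.single i U v =
      P.single i U (f • v) := by
  classical
  rw [scalar_smul]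
  exact (Pi.single_smul (f := (P.V · U)) i f v).symm

theorem proj_scalar_smul (U : Opens X) (i : Q₀) (f : SmoothFun d U) (v : P.Total U) :
    P.proj i U ((BimoduleTensorAlgebra.scalar (fun _ ↦ f) : PathAlg s t M U) • v) =
      f • P.proj i U v := by
  rw [scalar_smul]
  rfl

variable {P} {P' : TwistedPresheaf s t M}

/-- The additive maps on sections underlying a morphism of presheaves of modules. -/
def sectionMap (k : P.presheafModule ⟶ P'.presheafModule) (U : Opens X) :
    P.Total U →+ P'.Total U :=
  AddMonoidHom.mk' (fun v ↦ (k.app (op U)).hom v) (fun v w ↦ map_add (k.app (op U)).hom v w)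

theorem sectionMap_smul (k : P.presheafModule ⟶ P'.presheafModule) (U : Opens X)
    (x : PathAlg s t M U) (v : P.Total U) : sectionMap k U (x • v) = x • sectionMap k U v :=
  (k.app (op U)).hom.map_smul' x v

theorem resTotal_sectionMap (k : P.presheafModule ⟶ P'.presheafModule) {U W : Opens X}
    (h : W ≤ U) (v : P.Total U) :
    P'.resTotal h (sectionMap k U v) = sectionMap k W (P.resTotal h v) :=
  (PresheafOfModules.naturality_apply k (homOfLE h).op v).symm

/-- A morphism of the associated presheaves of modules over the path algebra gives a morphism of
twisted representations. -/
def Hom.ofPresheafHom (k : P.presheafModule ⟶ P'.presheafModule) : P.Hom P' where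
  app i U :=
    { toFun := fun v ↦ P'.proj i U (sectionMap k U (P.single i U v))
      map_add' := fun v w ↦ by rw [map_add, map_add, map_add]
      map_smul' := fun f v ↦ by
        rw [← scalar_smul_single, sectionMap_smul, proj_scalar_smul, RingHom.id_apply] }
  naturality i U W h v := by
    change P'.res i h (P'.proj i U (sectionMap k U (P.single i U v))) =
      P'.proj i W (sectionMap k W (P.single i W (P.res i h v)))
    rw [← proj_resTotal, resTotal_sectionMap, resTotal_single]
  app_act a U v m := by
    change P'.proj (t a) U (sectionMap k U (P.single (t a) U (P.act a U v m))) =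
      P'.act a U (P'.proj (s a) U (sectionMap k U (P.single (s a) U v))) m
    -- Only the diagonal blocks of `k` are kept, and it is not needed that the others vanish. On the
    -- right-hand side of this relation the arrow itself projects to the component at `s a`, and
    -- projecting the left-hand side to `t a` gives the other diagonal block.
    have h := sectionMap_smul k U (BimoduleTensorAlgebra.vector (arrowSingle s t M a U m))
      (P.single (s a) U v)
    rw [vector_smul, vector_smul, arrowFun_arrowSingle, arrowFun_arrowSingle, proj_single] at h
    rw [h, proj_single]

theorem Hom.ofPresheafHom_app (k : P.presheafModule ⟶ P'.presheafModule) (i : Q₀) (U : Opens X)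
    (v : P.V i U) :
    (Hom.ofPresheafHom k).app i U v = P'.proj i U (sectionMap k U (P.single i U v)) := rfl

/-- A left inverse of a morphism of presheaves of modules that comes from a morphism of twisted
representations gives a left inverse of the latter. -/
theorem Hom.ofPresheafHom_app_app {j : P.Hom P'} {k : P'.presheafModule ⟶ P.presheafModule}
    (h : j.presheafHom ≫ k = 𝟙 _) (i : Q₀) (U : Opens X) (v : P.V i U) :
    (Hom.ofPresheafHom k).app i U (j.app i U v) = v := by
  -- Since `j` sends the summand at `i` into the summand at `i`, passing to the diagonal block of
  -- `k` preserves the left inverse property.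
  have hs (w : P.Total U) : sectionMap k U (j.total U w) = w :=
    congrArg (fun k ↦ sectionMap k U w) h
  rw [ofPresheafHom_app, ← total_single, hs, proj_single]

end TwistedPresheaf

/-! ### Descent of the splitting from sheaves to presheaves. -/

namespace TwistedBundle

/-- A section of the total presheaf is a family indexed by the vertices, so existence and uniqueness
of gluings hold vertex by vertex. -/
theorem isSheaf_totalPresheaf (R : TwistedBundle s t M) :
    TopCat.Presheaf.IsSheaf (X := TopCat.of X) R.toPresheaf.totalPresheaf := by
  rw [TopCat.Presheaf.isSheaf_iff_isSheafUniqueGluing]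
  intro ι U σ hσ
  choose τ hτ hu using fun i ↦ existsUnique_gluing_sec (R.E i) U (fun j ↦ σ j i)
    (fun j k ↦ congrFun (hσ j k) i)
  refine ⟨τ, fun j ↦ funext fun i ↦ hτ i j, fun τ' h ↦ funext fun i ↦ hu i _ fun j ↦ ?_⟩
  exact congrFun (h j) i

section

variable [Fintype Q₁]

instance (R : TwistedBundle s t M) :
    IsIso ((PresheafOfModules.sheafificationAdjunction.{u} (toPathSheaf s t M)).unit.app
      R.toPresheaf.presheafModule) := by
  -- On underlying abelian presheaves the unit is the map to the associated sheaf, which is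
  -- invertible on a sheaf. The forgetful functor reflects isomorphisms.
  have h : IsIso ((PresheafOfModules.toPresheaf.{u} _).map
      ((PresheafOfModules.sheafificationAdjunction.{u} (toPathSheaf s t M)).unit.app
        R.toPresheaf.presheafModule)) :=
    isIso_toSheafify (Opens.grothendieckTopology X) R.isSheaf_totalPresheaf
  exact isIso_of_reflects_iso _ (PresheafOfModules.toPresheaf.{u} _)

end

variable [IsManifold (𝓡 d) ∞ X] (R : TwistedBundle s t M)
  (γ : ∀ a, SheafTensorHom (R.E (s a)) (M a) (formBundle (R.E (t a))))

/-- A retraction ends in the sheafification of `T_X^* ⊗ R`, so invertibility of the adjunction unit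
at this one object suffices to bring it back to presheaves. Conversely, sheafification carries a
presheaf retraction to a retraction of sheaves. -/
theorem toExt_eq_zero_iff_presheaf [Fintype Q₁] :
    R.toExt γ = 0 ↔ ∃ ρ : (R.extension γ).presheafModule ⟶ R.form.toPresheaf.presheafModule,
      (R.extensionIncl γ).presheafHom ≫ ρ = 𝟙 _ := by
  refine (R.sheafSeq_shortExact γ).extClass_eq_zero_iff.trans ⟨?_, ?_⟩
  · rintro ⟨r, hr⟩
    exact (PresheafOfModules.sheafificationAdjunction.{u}
      (toPathSheaf s t M)).exists_retraction_of_map _ r hr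
  · rintro ⟨ρ, hρ⟩
    refine ⟨(PresheafOfModules.sheafification.{u} (toPathSheaf s t M)).map ρ, ?_⟩
    exact ((PresheafOfModules.sheafification.{u} (toPathSheaf s t M)).map_comp _ ρ).symm.trans
      ((congrArg _ hρ).trans (CategoryTheory.Functor.map_id _ _))

/-! ### Primitives, retractions of the extension, and relative connections. -/

/-- A trivialization of the extension given by `γ`: homomorphisms of sheaves of modules
`α_i : E_i → T_X^* ⊗ E_i` whose commutator with the maps of the arrows is `γ`. -/
structure Primitive where
  /-- the maps on sections -/
  map : ∀ (i : Q₀) (U : Opens X), Sec (R.E i) U →ₗ[SmoothFun d U] Sec (formBundle (R.E i)) U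
  naturality : ∀ (i : Q₀) {U V : Opens X} (h : V ≤ U) (σ : Sec (R.E i) U),
    resSec (formBundle (R.E i)) h (map i U σ) = map i V (resSec (R.E i) h σ)
  map_act : ∀ (a : Q₁) (U : Opens X) (σ : Sec (R.E (s a)) U) (m : Sec (M a) U),
    map (t a) U ((R.φ a).toSheaf.map U σ m) =
      (R.φ a).formLeft.toSheaf.map U (map (s a) U σ) m + (γ a).map U σ m

variable {R γ}

/-- The retraction `(η, e) ↦ η - α e` of the extension. -/
def Primitive.retraction (α : R.Primitive γ) : (R.extension γ).Hom R.form.toPresheaf where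
  app i U := LinearMap.fst (SmoothFun d U) (Sec (formBundle (R.E i)) U) (Sec (R.E i) U) -
    α.map i U ∘ₗ LinearMap.snd (SmoothFun d U) (Sec (formBundle (R.E i)) U) (Sec (R.E i) U)
  naturality i U W h v := by
    change resSec (formBundle (R.E i)) h (v.1 - α.map i U v.2) =
      resSec (formBundle (R.E i)) h v.1 - α.map i W (resSec (R.E i) h v.2)
    rw [AddMonoidHom.map_sub, α.naturality]
  app_act a U v m := by
    change (R.φ a).formLeft.toSheaf.map U v.1 m + (γ a).map U v.2 m -
        α.map (t a) U ((R.φ a).toSheaf.map U v.2 m) =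
      (R.φ a).formLeft.toSheaf.map U (v.1 - α.map (s a) U v.2) m
    rw [α.map_act, LinearMap.map_sub, LinearMap.sub_apply]
    abel

theorem Primitive.incl_retraction [Fintype Q₁] (α : R.Primitive γ) :
    (R.extensionIncl γ).presheafHom ≫ α.retraction.presheafHom = 𝟙 _ := by
  ext U v
  refine funext fun i ↦ ?_
  change (show Sec (formBundle (R.E i)) U.unop from v i) - α.map i U.unop 0 = v i
  rw [LinearMap.map_zero, sub_zero]

/-- The homomorphisms `α_i` given by a retraction of the extension. -/
def Primitive.ofRetraction (κ : (R.extension γ).Hom R.form.toPresheaf)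
    (hκ : ∀ (i : Q₀) (U : Opens X) (η : Sec (formBundle (R.E i)) U),
      κ.app i U ((R.extensionIncl γ).app i U η) = η) : R.Primitive γ where
  -- A retraction is the identity on `T_X^* ⊗ E_i`, hence has the form `(η, e) ↦ η + κ (0, e)`. The
  -- sign matches the convention `η - α e`.
  map i U := -(κ.app i U ∘ₗ
    LinearMap.inr (SmoothFun d U) (Sec (formBundle (R.E i)) U) (Sec (R.E i) U))
  naturality i U V h σ := by
    have hκ' := κ.naturality i h ((0, σ) : Sec (formBundle (R.E i)) U × Sec (R.E i) U)
    have h0 : (R.extension γ).res i h ((0, σ) : Sec (formBundle (R.E i)) U × Sec (R.E i) U) =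
        ((0, resSec (R.E i) h σ) : Sec (formBundle (R.E i)) V × Sec (R.E i) V) :=
      Prod.ext (map_zero (resSec (formBundle (R.E i)) h)) rfl
    rw [h0] at hκ'
    exact (map_neg (resSec (formBundle (R.E i)) h) _).trans (congrArg Neg.neg hκ')
  map_act a U σ m := by
    have h := κ.app_act a U ((0, σ) : Sec (formBundle (R.E (s a))) U × Sec (R.E (s a)) U) m
    -- The arrow sends `(0, σ) ⊗ m` to `(γ_a (σ ⊗ m), φ_a (σ ⊗ m))`. Its first component lies in the
    -- image of the inclusion, where `κ` is known, so applying `κ` yields the equation of a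
    -- primitive up to sign.
    have h0 : (R.extension γ).act a U
        ((0, σ) : Sec (formBundle (R.E (s a))) U × Sec (R.E (s a)) U) m =
        (R.extensionIncl γ).app (t a) U ((γ a).map U σ m) +
          (show (R.extension γ).V (t a) U from (0, (R.φ a).toSheaf.map U σ m)) := by
      refine Prod.ext ?_ (zero_add ((R.φ a).toSheaf.map U σ m)).symm
      change (R.φ a).formLeft.toSheaf.map U 0 m + (γ a).map U σ m = (γ a).map U σ m + 0
      rw [LinearMap.map_zero, LinearMap.zero_apply, zero_add, add_zero]
    rw [h0, map_add, hκ] at h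
    let x : Sec (formBundle (R.E (t a))) U :=
      κ.app (t a) U (show (R.extension γ).V (t a) U from (0, (R.φ a).toSheaf.map U σ m))
    let y : Sec (formBundle (R.E (s a))) U :=
      κ.app (s a) U (show (R.extension γ).V (s a) U from (0, σ))
    change (γ a).map U σ m + x = (R.φ a).formLeft.toSheaf.map U y m at h
    change -x = (R.φ a).formLeft.toSheaf.map U (-y) m + (γ a).map U σ m
    rw [LinearMap.map_neg, LinearMap.neg_apply, ← h]
    abel

theorem toExt_eq_zero_iff_nonempty_primitive [Fintype Q₁] :
    R.toExt γ = 0 ↔ Nonempty (R.Primitive γ) := by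
  rw [toExt_eq_zero_iff_presheaf]
  exact ⟨fun ⟨ρ, hρ⟩ ↦ ⟨Primitive.ofRetraction (TwistedPresheaf.Hom.ofPresheafHom ρ)
    (TwistedPresheaf.Hom.ofPresheafHom_app_app hρ)⟩, fun ⟨α⟩ ↦
    ⟨α.retraction.presheafHom, α.incl_retraction⟩⟩

/-- The correspondence is `α_i = ∇_i - ∇⁰_i`. The equation of a primitive of the defects is the
compatibility condition rewritten in terms of this difference. -/
theorem exists_relativeConnection_iff [T2Space X] (DM : ∀ a, SmoothConnection (M a))
    (D₀ : ∀ i, SmoothConnection (R.E i)) :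
    (∃ C : R.RelativeConnection, C.arrow = DM) ↔ Nonempty (R.Primitive (R.defects DM D₀)) := by
  constructor
  · rintro ⟨C, rfl⟩
    refine ⟨fun i U ↦ (C.vertex i).difference (D₀ i) U,
      fun i U V h σ ↦ (C.vertex i).difference_res (D₀ i) h σ, fun a U σ m ↦ ?_⟩
    have h := C.compatible a U σ m
    change (C.vertex (t a)).nabla ((R.φ a).toSheaf.map U σ m) -
        (D₀ (t a)).nabla ((R.φ a).toSheaf.map U σ m) =
      (R.φ a).formLeft.toSheaf.map U ((C.vertex (s a)).nabla σ - (D₀ (s a)).nabla σ) m +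
        (tensorNabla (R.φ a) (D₀ (s a)) (C.arrow a) σ m -
          (D₀ (t a)).nabla ((R.φ a).toSheaf.map U σ m))
    -- Compatibility of `C` replaces `∇ (φ (σ ⊗ m))` by its expansion. The terms in the derivative
    -- of `m` then cancel, because both expansions use the same connection on `M_a`.
    rw [← h, LinearMap.map_sub, LinearMap.sub_apply, tensorNabla, tensorNabla]
    abel
  · rintro ⟨α⟩
    refine ⟨⟨fun i ↦ (D₀ i).addForm (α.map i) (α.naturality i), DM, fun a U σ m ↦ ?_⟩, rfl⟩
    rw [SmoothConnection.addForm_nabla, α.map_act, tensorNabla, SmoothConnection.addForm_nabla,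
      LinearMap.map_add, LinearMap.add_apply]
    change _ = (D₀ (t a)).nabla ((R.φ a).toSheaf.map U σ m) + (_ +
      (tensorNabla (R.φ a) (D₀ (s a)) (DM a) σ m - (D₀ (t a)).nabla ((R.φ a).toSheaf.map U σ m)))
    rw [tensorNabla]
    abel

end TwistedBundle

end

end QuiverBundle

theorem propositionP {d : ℕ} {X : Type u} [TopologicalSpace X] [T2Space X]
    [SecondCountableTopology X] [ConnectedSpace X] [ChartedSpace (EuclideanSpace ℝ (Fin d)) X]
    [IsManifold (𝓡 d) ∞ X] {Q₀ Q₁ : Type u} [Fintype Q₀] [Fintype Q₁] (s t : Q₁ → Q₀)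
    (M : Q₁ → QuiverBundle.SmoothVB d X) (DM : ∀ a, QuiverBundle.SmoothConnection (M a))
    (R : QuiverBundle.TwistedBundle s t M) (D₀ : ∀ i, QuiverBundle.SmoothConnection (R.E i)) :
    (∃ C : R.RelativeConnection, C.arrow = DM) ↔ R.toExt (R.defects DM D₀) = 0 := by
  rw [QuiverBundle.TwistedBundle.exists_relativeConnection_iff DM D₀,
    QuiverBundle.TwistedBundle.toExt_eq_zero_iff_nonempty_primitive]
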